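/- Let $T(r,f)$ denote the Nevanlinna characteristic. A meromorphic function $f$ in $\mathbb{C}$ has finite order if $\limsup_{r\to\infty}\log^+T(r,f)/\log r<\infty$. Let $\mathcal{S}(f)$ be the set of meromorphic functions $a$ such that $T(r,a)=o(T(r,f))$ as $r\to\infty$ outside of a set $E\subset(0,\infty)$ of finite logarithmic measure $\int_E dr/r<\infty$. A meromorphic function $f$ is periodic with period $c$ if $f(z+c)\equiv f(z)$. For $c\in\mathbb{C}$, meromorphic functions $f,a$ and $z_0\in\mathbb{C}$ put $h=f-a$ and let $p\in\{0,1,2,\dots,\infty\}$ be the multiplicity of $z_0$ as a zero of $h$ ($p=0$ if $z_0$ is not a zero, $p=\infty$ if $h\equiv0$). If $h(z_0)=0$ and $h(z_0+c)=0$, then $z_0$ is a $c$-separated $a$-pair of $f$, and it is counted $\nu$ times, where $\nu\in\{1,2,\dots,\infty\}$ is the number of equal terms in the beginning of the Taylor expansions of $h(z)$ and $h(z+c)$ about $z_0$, i.e. the order of vanishing of $h(z+c)-h(z)$ at $z_0$; otherwise put $\nu=0$. Thus $u(z_0;f,a):=\max\{p-\nu,0\}$ (and $0$ if $p=\nu=\infty$)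 is the number of $a$-points of $f$ at $z_0$, counted with multiplicity, that are not in $c$-separated pairs. We say that $f$ and $g$ share $a$, ignoring $c$-separated pairs, if $u(z_0;f,a)=u(z_0;g,a)$ for every $z_0\in\mathbb{C}$. **Theorem.** Let $c\in\mathbb{C}$, and let $f$ and $g$ be meromorphic functions in $\mathbb{C}$ of finite order. Let $a_1,\dots,a_5\in\mathcal{S}(f)$ be five distinct periodic functions with period $c$; if $f$ is periodic with period $c$, assume in addition that $a_1,\dots,a_5\in\mathcal{S}(g)$. If $f$ and $g$ share $a_k$, ignoring $c$-separated pairs, for all $k=1,\dots,5$, then either $f\equiv g$, or both $f$ and $g$ are periodic with period $c$. -/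

import Mathlib

open Filter Topology MeasureTheory ValueDistribution

/-- The order of growth `limsup log⁺ T(r, f) / log r` of a meromorphic function, where
`characteristic f ⊤` is the Nevanlinna characteristic `r ↦ T(r, f) = m(r, f) + N(r, f)`. -/
noncomputable def growthOrder (f : ℂ → ℂ) : EReal :=
  limsup (fun r : ℝ => ((Real.posLog (characteristic f ⊤ r) / Real.log r : ℝ) : EReal)) atTop

/-- `f` is a meromorphic function in the plane, of finite order. -/
def IsFiniteOrderMeromorphic (f : ℂ → ℂ) : Prop :=
  Meromorphic f ∧ growthOrder f < ⊤

/-- Identity of meromorphic functions: equality off a closed discrete subset of the plane (the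
values which a function `ℂ → ℂ` is given at its poles are irrelevant). -/
def MeromorphicEq (f g : ℂ → ℂ) : Prop :=
  f =ᶠ[codiscrete ℂ] g

/-- The meromorphic function `f` is periodic with period `c`: `f(z + c) ≡ f(z)`. -/
def IsPeriodicWith (c : ℂ) (f : ℂ → ℂ) : Prop :=
  MeromorphicEq (fun z => f (z + c)) f

/-- `E ⊆ (0, ∞)` has finite logarithmic measure, `∫_E dr / r < ∞`. -/
def HasFiniteLogMeasure (E : Set ℝ) : Prop :=
  MeasurableSet E ∧ E ⊆ Set.Ioi 0 ∧ ∫⁻ r in E, ENNReal.ofReal (1 / r) < ⊤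

/-- `a ∈ 𝒮(f)`: `a` is meromorphic and `T(r, a) = o(T(r, f))` as `r → ∞` outside of a set of finite
logarithmic measure. -/
def IsSmallFor (a f : ℂ → ℂ) : Prop :=
  Meromorphic a ∧ ∃ E : Set ℝ, HasFiniteLogMeasure E ∧
    characteristic a ⊤ =o[atTop ⊓ 𝓟 Eᶜ] characteristic f ⊤

/-- The multiplicity of `z` as a zero of the meromorphic function `h`: `0` if `z` is not a zero of
`h` (in particular if it is a pole), and `⊤` if `h ≡ 0`. -/
noncomputable def zeroMultiplicity (h : ℂ → ℂ) (z : ℂ) : ℕ∞ :=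
  WithTop.map Int.toNat (meromorphicOrderAt h z)

open Classical in
/-- How often `z` is counted as a `c`-separated `0`-pair of `h`: if `h(z) = 0` and `h(z + c) = 0`,
this is the number of equal terms in the beginning of the Taylor expansions of `w ↦ h w` and
`w ↦ h (w + c)` about `z`, that is, the order of vanishing of `h (w + c) - h w` at `w = z`;
otherwise it is `0`. -/
noncomputable def pairMultiplicity (c : ℂ) (h : ℂ → ℂ) (z : ℂ) : ℕ∞ :=
  if zeroMultiplicity h z ≠ 0 ∧ zeroMultiplicity h (z + c) ≠ 0 then
    zeroMultiplicity (fun w => h (w + c) - h w) z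
  else 0

/-- The number of zeros of `h` at `z`, counted with multiplicity, that are left after the
`c`-separated `0`-pairs are removed (truncated subtraction in `ℕ∞`; `⊤ - ⊤ = 0`). -/
noncomputable def unpairedMultiplicity (c : ℂ) (h : ℂ → ℂ) (z : ℂ) : ℕ∞ :=
  zeroMultiplicity h z - pairMultiplicity c h z

/-- `f` and `g` share `a`, ignoring `c`-separated pairs: after removal of the paired points of each
function, `f` and `g` have the same `a`-points, with the same multiplicities. -/
def ShareIgnoringPairs (c : ℂ) (f g a : ℂ → ℂ) : Prop :=
  ∀ z : ℂ, unpairedMultiplicity c (fun w => f w - a w) z =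
    unpairedMultiplicity c (fun w => g w - a w) z

/-! ### Radii outside sets of finite logarithmic measure -/

/-! Suppose f is not periodic, so δ(z) = f(z+c) − f(z) is not identically 0. Since a_k has period c,
δ = (f − a_k)(q_k − 1) with q_k the quotient of f − a_k at z+c and at z. The difference analogue of
the lemma on the logarithmic derivative (`isLittleO_proximity_shift_div`) gives m(r, q_k) =
o(T(r,f)). Hence δ is small wherever f is close to some a_k, and Σ m(r, 1/(f−a_k)) ≤ m(r, 1/δ) +
o(T(r,f)). On the counting side, a c-separated a_k-pair is a zero of δ with its multiplicity, so Σ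
N(r, 1/(f−a_k)) ≤ N(r, 1/δ) + N(r, B) + o(T(r,f)), where B bounds the unpaired points. As T(r,δ) ≤
T(r,f) + N(r, f(z+c)) + o(T(r,f)) ≤ (5/2 + o(1)) T(r,f), n targets yield (n − 5/2 − ε) T(r,f) ≤ N(r,
B) (`eventually_le_logCounting`).

Shared unpaired points are zeros of f − g. If f ≢ g, then N(r, B) ≤ T(r,f) + T(r,g) + O(1), and n =
5 leaves 9/8 T(r,f) ≤ T(r,g). If g is not periodic either, the roles can be exchanged, which is
impossible since T → ∞. If exactly one function is periodic, it has no unpaired points, so neither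
has the other; then B = 0 and the estimate fails.

Finite order enters through `MonotoneOn.eventually_le_mul`: off a set of finite logarithmic measure,
T hardly grows from r to r + 2r^(3/4). -/

theorem HasFiniteLogMeasure.union {E F : Set ℝ} (hE : HasFiniteLogMeasure E)
    (hF : HasFiniteLogMeasure F) : HasFiniteLogMeasure (E ∪ F) :=
  ⟨hE.1.union hF.1, Set.union_subset hE.2.1 hF.2.1,
    (lintegral_union_le _ E F).trans_lt (ENNReal.add_lt_top.2 ⟨hE.2.2, hF.2.2⟩)⟩

theorem HasFiniteLogMeasure.empty : HasFiniteLogMeasure ∅ :=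
  ⟨MeasurableSet.empty, Set.empty_subset _, by simp⟩

/-- The filter of all sets of radii which contain every large radius outside of some set of finite
logarithmic measure. -/
def logMeasureFilter : Filter ℝ where
  sets := {S | ∃ E, HasFiniteLogMeasure E ∧ ∃ R, Set.Ici R \ E ⊆ S}
  univ_sets := ⟨∅, .empty, 0, Set.subset_univ _⟩
  sets_of_superset := fun ⟨E, hE, R, h⟩ hST => ⟨E, hE, R, h.trans hST⟩
  inter_sets := by
    rintro S T ⟨E, hE, R, hS⟩ ⟨F, hF, Q, hT⟩
    refine ⟨E ∪ F, hE.union hF, max R Q, fun r hr => ⟨hS ⟨?_, ?_⟩, hT ⟨?_, ?_⟩⟩⟩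
    · exact (le_max_left _ _).trans (Set.mem_Ici.1 hr.1)
    · exact fun h => hr.2 (Or.inl h)
    · exact (le_max_right _ _).trans (Set.mem_Ici.1 hr.1)
    · exact fun h => hr.2 (Or.inr h)

theorem eventually_logMeasureFilter {p : ℝ → Prop} : (∀ᶠ r in logMeasureFilter, p r) ↔
    ∃ E, HasFiniteLogMeasure E ∧ ∃ R, ∀ r, R ≤ r → r ∉ E → p r :=
  ⟨fun ⟨E, hE, R, h⟩ => ⟨E, hE, R, fun _ h1 h2 => h ⟨h1, h2⟩⟩,
    fun ⟨E, hE, R, h⟩ => ⟨E, hE, R, fun _ hr => h _ hr.1 hr.2⟩⟩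

theorem logMeasureFilter_le_atTop : logMeasureFilter ≤ atTop := by
  intro S hS
  obtain ⟨R, hR⟩ := mem_atTop_sets.1 hS
  exact ⟨∅, .empty, R, fun r hr => hR r hr.1⟩

theorem HasFiniteLogMeasure.logMeasureFilter_le {E : Set ℝ} (hE : HasFiniteLogMeasure E) :
    logMeasureFilter ≤ atTop ⊓ 𝓟 Eᶜ :=
  le_inf logMeasureFilter_le_atTop (le_principal_iff.2 ⟨E, hE, 0, fun _ hr => hr.2⟩)

/-- A set of finite logarithmic measure leaves a point in each interval `[r, κ r]`, for a suitable
constant `κ`. -/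
theorem HasFiniteLogMeasure.exists_notMem {E : Set ℝ} (hE : HasFiniteLogMeasure E) :
    ∃ κ : ℝ, 1 ≤ κ ∧ ∀ r, 0 < r → ∃ s ∈ Set.Icc r (κ * r), s ∉ E := by
  set M := (∫⁻ r in E, ENNReal.ofReal (1 / r)).toReal with hM
  have hM0 : 0 ≤ M := ENNReal.toReal_nonneg
  -- The interval [r, e^(M+1) r] has logarithmic measure M + 1, more than the M of E.
  have hκ : 1 ≤ Real.exp (M + 1) := Real.one_le_exp (by linarith)
  refine ⟨Real.exp (M + 1), hκ, fun r hr => ?_⟩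
  by_contra! hcon
  have hrr : r ≤ Real.exp (M + 1) * r := le_mul_of_one_le_left hr.le hκ
  have hI : ∫ t in Set.Icc r (Real.exp (M + 1) * r), 1 / t = M + 1 := by
    rw [integral_Icc_eq_integral_Ioc, ← intervalIntegral.integral_of_le hrr,
      integral_one_div_of_pos hr (by positivity), mul_div_assoc, div_self hr.ne', mul_one,
      Real.log_exp]
  have hint : IntegrableOn (fun t : ℝ => 1 / t) (Set.Icc r (Real.exp (M + 1) * r)) := by
    apply ContinuousOn.integrableOn_compact isCompact_Icc
    exact continuousOn_const.div continuousOn_id fun t ht => (hr.trans_le ht.1).ne'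
  have h0 : ∀ᵐ t ∂(volume.restrict (Set.Icc r (Real.exp (M + 1) * r))), 0 ≤ 1 / t := by
    filter_upwards [ae_restrict_mem measurableSet_Icc] with t ht
    exact one_div_nonneg.2 (hr.le.trans ht.1)
  have h1 := ofReal_integral_eq_lintegral_ofReal hint h0
  have h2 : ∫⁻ t in Set.Icc r (Real.exp (M + 1) * r), ENNReal.ofReal (1 / t) ≤
      ∫⁻ t in E, ENNReal.ofReal (1 / t) := lintegral_mono_set fun t ht => hcon t ht
  rw [← h1, hI, ← ENNReal.ofReal_toReal hE.2.2.ne, ← hM,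
    ENNReal.ofReal_le_ofReal_iff hM0] at h2
  linarith

/-- Estimates valid along the filter thus hold at a common radius, from which the final
contradictions are drawn. -/
instance : logMeasureFilter.NeBot := by
  refine ⟨fun h => ?_⟩
  obtain ⟨E, hE, R, hR⟩ := (Filter.empty_mem_iff_bot.2 h : ∅ ∈ logMeasureFilter)
  obtain ⟨κ, -, h⟩ := hE.exists_notMem
  obtain ⟨s, hs, hsE⟩ := h (max R 1) (by positivity)
  exact hR ⟨(le_max_left _ _).trans hs.1, hsE⟩

/-! ### Growth of monotone functions of finite order -/

/-- Markov's inequality: the integral of G(r+l) − G(r) telescopes to the integral of G over [Y, Y+l]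
minus that over [X, X+l]. -/
theorem Monotone.volume_setOf_lt_sub_le {G : ℝ → ℝ} (hG : Monotone G) {X Y l ε : ℝ} (hXY : X ≤ Y)
    (hl : 0 ≤ l) (hε : 0 < ε) :
    volume {r | r ∈ Set.Ioc X Y ∧ ε < G (r + l) - G r} ≤
      ENNReal.ofReal (l * (G (Y + l) - G X) / ε) := by
  have hGi : ∀ a b, IntervalIntegrable G volume a b := fun a b => hG.intervalIntegrable
  have hGl : Monotone fun r => G (r + l) := fun a b hab => hG (by linarith)
  have hi : IntervalIntegrable (fun r => G (r + l) - G r) volume X Y :=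
    hGl.intervalIntegrable.sub (hGi X Y)
  have h1 : ∫ r in X..Y, (G (r + l) - G r) ≤ l * (G (Y + l) - G X) := by
    rw [intervalIntegral.integral_sub hGl.intervalIntegrable (hGi X Y),
      intervalIntegral.integral_comp_add_right (fun r => G r)]
    have e1 := intervalIntegral.integral_add_adjacent_intervals (hGi (X + l) Y) (hGi Y (Y + l))
    have e2 := intervalIntegral.integral_add_adjacent_intervals (hGi X (X + l)) (hGi (X + l) Y)
    have b1 : ∫ r in Y..(Y + l), G r ≤ ∫ r in Y..(Y + l), G (Y + l) :=
      intervalIntegral.integral_mono_on (by linarith) (hGi _ _) (by simp) fun r hr => hG hr.2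
    have b2 : ∫ r in X..(X + l), G X ≤ ∫ r in X..(X + l), G r :=
      intervalIntegral.integral_mono_on (by linarith) (by simp) (hGi _ _) fun r hr => hG hr.1
    simp only [intervalIntegral.integral_const, add_sub_cancel_left, smul_eq_mul] at b1 b2
    linarith
  rw [intervalIntegral.integral_of_le hXY] at h1
  have h2 := mul_meas_ge_le_integral_of_nonneg (μ := volume.restrict (Set.Ioc X Y))
    (f := fun r => G (r + l) - G r)
    (Eventually.of_forall fun r => sub_nonneg.2 (hG (by linarith)))
    ((intervalIntegrable_iff_integrableOn_Ioc_of_le hXY).1 hi) ε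
  have hm : MeasurableSet {r | ε ≤ G (r + l) - G r} :=
    measurableSet_le measurable_const (hGl.measurable.sub hG.measurable)
  rw [measureReal_def, Measure.restrict_apply hm] at h2
  have hfin : volume ({r | ε ≤ G (r + l) - G r} ∩ Set.Ioc X Y) ≠ ⊤ :=
    ((measure_mono Set.inter_subset_right).trans_lt measure_Ioc_lt_top).ne
  calc volume {r | r ∈ Set.Ioc X Y ∧ ε < G (r + l) - G r}
      ≤ volume ({r | ε ≤ G (r + l) - G r} ∩ Set.Ioc X Y) :=
        measure_mono fun r hr => ⟨hr.2.le, hr.1⟩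
    _ = ENNReal.ofReal (volume ({r | ε ≤ G (r + l) - G r} ∩ Set.Ioc X Y)).toReal :=
        (ENNReal.ofReal_toReal hfin).symm
    _ ≤ _ := by
        apply ENNReal.ofReal_le_ofReal
        rw [le_div_iff₀ hε]
        linarith

/-- On the block (2^k, 2^(k+1)] the step is O(2^(3k/4)) and G varies by O(k+1), so the bad radii
have logarithmic measure O((k+1) 2^(−k/4)), which is summable. -/
theorem Monotone.eventually_sub_le {G : ℝ → ℝ} (hG : Monotone G) (hG0 : ∀ r, 0 ≤ G r) {K C : ℝ}
    (hK : ∀ r, 1 ≤ r → G r ≤ K * Real.log r + C) {ε : ℝ} (hε : 0 < ε) :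
    ∀ᶠ r in logMeasureFilter, G (r + 2 * r ^ (3 / 4 : ℝ)) - G r ≤ ε := by
  set l : ℕ → ℝ := fun k => 2 * (2 ^ (k + 1) : ℝ) ^ (3 / 4 : ℝ) with hl
  have hl0 : ∀ k, 0 ≤ l k := fun k => by positivity
  set E : ℕ → Set ℝ := fun k =>
    {r | r ∈ Set.Ioc ((2 : ℝ) ^ k) (2 ^ (k + 1)) ∧ ε < G (r + l k) - G r} with hE
  have hmeas : ∀ k, MeasurableSet (E k) := fun k => by
    have h : MeasurableSet {r | ε < G (r + l k) - G r} := measurableSet_lt measurable_const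
      ((hG.measurable.comp (measurable_add_const _)).sub hG.measurable)
    exact measurableSet_Ioc.inter h
  set b : ℕ → ℝ := fun k => 4 * (|K| * ((k + 3) * Real.log 2) + |C|) / ε *
    ((2 : ℝ) ^ (-(1 / 4) : ℝ)) ^ k with hb
  have hq : ‖(2 : ℝ) ^ (-(1 / 4) : ℝ)‖ < 1 := by
    rw [Real.norm_of_nonneg (by positivity)]
    exact Real.rpow_lt_one_of_one_lt_of_neg (by norm_num) (by norm_num)
  have hbs : Summable b := by
    have s1 := summable_pow_mul_geometric_of_norm_lt_one 1 hq
    have s0 := summable_geometric_of_norm_lt_one hq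
    refine ((s1.mul_left (4 * |K| * Real.log 2 / ε)).add
      (s0.mul_left (4 * (|K| * (3 * Real.log 2) + |C|) / ε))).congr fun k => ?_
    simp only [hb, pow_one]
    ring
  have hEk : ∀ k, ∫⁻ r in E k, ENNReal.ofReal (1 / r) ≤ ENNReal.ofReal (b k) := by
    intro k
    have p2 : (0 : ℝ) < 2 ^ k := by positivity
    have hlk : l k ≤ 2 * 2 ^ (k + 1) := by
      have : ((2 : ℝ) ^ (k + 1)) ^ (3 / 4 : ℝ) ≤ ((2 : ℝ) ^ (k + 1)) ^ (1 : ℝ) :=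
        Real.rpow_le_rpow_of_exponent_le (one_le_pow₀ (by norm_num)) (by norm_num)
      rw [Real.rpow_one] at this
      simp only [hl]
      linarith
    have hlk' : l k / 2 ^ k ≤ 4 * ((2 : ℝ) ^ (-(1 / 4) : ℝ)) ^ k := by
      rw [div_le_iff₀ p2]
      simp only [hl]
      rw [← Real.rpow_natCast _ (k + 1), ← Real.rpow_natCast _ k, ← Real.rpow_natCast _ k,
        ← Real.rpow_mul (by norm_num), ← Real.rpow_mul (by norm_num), mul_assoc,
        ← Real.rpow_add (by norm_num)]
      have : (2 : ℝ) ^ (((k + 1 : ℕ) : ℝ) * (3 / 4)) ≤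
          2 * 2 ^ (-(1 / 4) * (k : ℝ) + k) := by
        nth_rewrite 2 [← Real.rpow_one 2]
        rw [← Real.rpow_add (by norm_num)]
        apply Real.rpow_le_rpow_of_exponent_le (by norm_num)
        push_cast
        linarith
      linarith
    have hGk : G (2 ^ (k + 1) + l k) - G (2 ^ k) ≤ |K| * ((k + 3) * Real.log 2) + |C| := by
      -- Indeed 2^(k+1) + l k ≤ 3 · 2^(k+1) ≤ 2^(k+3).
      have h1 : G (2 ^ (k + 1) + l k) ≤ G (2 ^ (k + 3)) := by
        apply hG
        rw [pow_succ _ (k + 2), pow_succ _ (k + 1)]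
        nlinarith [pow_pos (show (0 : ℝ) < 2 by norm_num) (k + 1)]
      have h2 := hK (2 ^ (k + 3)) (one_le_pow₀ (by norm_num))
      rw [Real.log_pow] at h2
      push_cast at h2
      have h3 : K * ((k + 3) * Real.log 2) ≤ |K| * ((k + 3) * Real.log 2) :=
        mul_le_mul_of_nonneg_right (le_abs_self K)
          (mul_nonneg (by positivity) (Real.log_nonneg (by norm_num)))
      linarith [hG0 (2 ^ k), le_abs_self C]
    calc ∫⁻ r in E k, ENNReal.ofReal (1 / r)
        ≤ ∫⁻ r in E k, ENNReal.ofReal (1 / 2 ^ k) := by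
          refine setLIntegral_mono measurable_const fun r hr => ?_
          exact ENNReal.ofReal_le_ofReal (one_div_le_one_div_of_le p2 hr.1.1.le)
      _ = ENNReal.ofReal (1 / 2 ^ k) * volume (E k) := setLIntegral_const _ _
      _ ≤ ENNReal.ofReal (1 / 2 ^ k) *
            ENNReal.ofReal (l k * (G (2 ^ (k + 1) + l k) - G (2 ^ k)) / ε) := by
          gcongr
          exact hG.volume_setOf_lt_sub_le (by rw [pow_succ]; linarith) (hl0 k) hε
      _ = ENNReal.ofReal (l k / 2 ^ k * ((G (2 ^ (k + 1) + l k) - G (2 ^ k)) / ε)) := by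
          rw [← ENNReal.ofReal_mul (by positivity)]
          congr 1
          ring
      _ ≤ ENNReal.ofReal (b k) := by
          apply ENNReal.ofReal_le_ofReal
          calc l k / 2 ^ k * ((G (2 ^ (k + 1) + l k) - G (2 ^ k)) / ε)
              ≤ 4 * ((2 : ℝ) ^ (-(1 / 4) : ℝ)) ^ k *
                  ((|K| * ((k + 3) * Real.log 2) + |C|) / ε) := by
                have : 0 ≤ G (2 ^ (k + 1) + l k) - G (2 ^ k) := by
                  refine sub_nonneg.2 (hG ?_)
                  rw [pow_succ]
                  linarith [hl0 k]
                gcongr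
            _ = b k := by simp only [hb]; ring
  refine eventually_logMeasureFilter.2 ⟨⋃ k, E k, ⟨MeasurableSet.iUnion hmeas, ?_, ?_⟩, 2, ?_⟩
  · refine Set.iUnion_subset fun k r hr => ?_
    exact (show (0 : ℝ) < 2 ^ k by positivity).trans hr.1.1
  · calc ∫⁻ r in ⋃ k, E k, ENNReal.ofReal (1 / r)
        ≤ ∑' k, ∫⁻ r in E k, ENNReal.ofReal (1 / r) := lintegral_iUnion_le _ _
      _ ≤ ∑' k, ENNReal.ofReal (b k) := ENNReal.tsum_le_tsum hEk
      _ < ⊤ := hbs.tsum_ofReal_lt_top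
  · intro r hr hrE
    obtain ⟨k, hk1, hk2⟩ := exists_mem_Ioc_zpow (show (0 : ℝ) < r by linarith)
      (show (1 : ℝ) < 2 by norm_num)
    have hk0 : 0 ≤ k := by
      by_contra! h
      have : (2 : ℝ) ^ (k + 1) ≤ 2 ^ (0 : ℤ) := zpow_le_zpow_right₀ (by norm_num) (by omega)
      rw [zpow_zero] at this
      linarith
    obtain ⟨n, rfl⟩ := Int.eq_ofNat_of_zero_le hk0
    have hk1' : (2 : ℝ) ^ n < r := by exact_mod_cast hk1
    have hk2' : r ≤ (2 : ℝ) ^ (n + 1) := by exact_mod_cast hk2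
    have h1 : ¬ ε < G (r + l n) - G r := fun h =>
      hrE (Set.mem_iUnion.2 ⟨n, ⟨hk1', hk2'⟩, h⟩)
    have h2 : G (r + 2 * r ^ (3 / 4 : ℝ)) ≤ G (r + l n) := by
      apply hG
      simp only [hl]
      gcongr
    linarith [not_lt.1 h1]

theorem MonotoneOn.eventually_le_mul {T : ℝ → ℝ} (hT : MonotoneOn T (Set.Ioi 0))
    (h1 : ∀ᶠ r in atTop, 1 ≤ T r) {K : ℝ} (hK : ∀ᶠ r in atTop, T r ≤ r ^ K) {A : ℝ} (hA : 1 < A) :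
    ∀ᶠ r in logMeasureFilter, T (r + 2 * r ^ (3 / 4 : ℝ)) ≤ A * T r := by
  obtain ⟨R, hR⟩ := eventually_atTop.1 (h1.and hK)
  set R₀ := max R 1
  have hR₀ : ∀ r, R₀ ≤ r → 1 ≤ T r ∧ T r ≤ r ^ K := fun r hr => hR r ((le_max_left _ _).trans hr)
  have hR1 : 1 ≤ R₀ := le_max_right _ _
  -- Freezing T below R₀ makes log T monotone and nonnegative on all of ℝ.
  set G : ℝ → ℝ := fun r => Real.log (T (max r R₀)) with hGdef
  have hTpos : ∀ r, 1 ≤ T (max r R₀) := fun r => (hR₀ _ (le_max_right _ _)).1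
  have hG : Monotone G := fun a b hab => by
    refine Real.log_le_log (by linarith [hTpos a]) (hT ?_ ?_ (max_le_max_right _ hab)) <;>
    exact (show (0 : ℝ) < R₀ by linarith).trans_le (le_max_right _ _)
  have hGK : ∀ r, 1 ≤ r → G r ≤ |K| * Real.log r + |K| * Real.log R₀ := by
    intro r hr
    have h2 : G r ≤ K * Real.log (max r R₀) := by
      have := Real.log_le_log (by linarith [hTpos r]) (hR₀ _ (le_max_right r R₀)).2
      rwa [Real.log_rpow (by positivity)] at this
    have h3 : Real.log (max r R₀) ≤ Real.log r + Real.log R₀ := by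
      have a1 := Real.log_nonneg hr
      have a2 := Real.log_nonneg hR1
      rcases max_cases r R₀ with h | h <;> rw [h.1] <;> linarith
    have h4 : 0 ≤ Real.log (max r R₀) := Real.log_nonneg (hr.trans (le_max_left _ _))
    calc G r ≤ K * Real.log (max r R₀) := h2
      _ ≤ |K| * Real.log (max r R₀) := by gcongr; exact le_abs_self K
      _ ≤ |K| * (Real.log r + Real.log R₀) := by gcongr
      _ = _ := by ring
  have := hG.eventually_sub_le (fun r => Real.log_nonneg (hTpos r)) hGK (Real.log_pos hA)
  filter_upwards [this, logMeasureFilter_le_atTop (eventually_ge_atTop R₀)] with r hr hrR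
  have hr' : R₀ ≤ r + 2 * r ^ (3 / 4 : ℝ) := by
    have : 0 ≤ r ^ (3 / 4 : ℝ) := Real.rpow_nonneg (by linarith) _
    linarith
  simp only [hGdef, max_eq_left hrR, max_eq_left hr'] at hr
  have p1 := (hR₀ _ hrR).1
  have p2 := (hR₀ _ hr').1
  rw [← Real.log_le_log_iff (by linarith) (by positivity), Real.log_mul (by linarith) (by linarith)]
  linarith

/-! ### Estimates for circle averages -/

theorem Real.circleAverage_mono_codiscreteWithin {c : ℂ} {R : ℝ} {f₁ f₂ : ℂ → ℝ}
    (hf₁ : CircleIntegrable f₁ c R) (hf₂ : CircleIntegrable f₂ c R) (hR : R ≠ 0)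
    (h : f₁ ≤ᶠ[codiscreteWithin (Metric.sphere c |R|)] f₂) :
    Real.circleAverage f₁ c R ≤ Real.circleAverage f₂ c R := by
  apply (mul_le_mul_iff_of_pos_left (by simp [Real.pi_pos])).2
  apply intervalIntegral.integral_mono_ae_restrict Real.two_pi_pos.le hf₁ hf₂
  exact ae_restrict_le_codiscreteWithin measurableSet_Icc
    (codiscreteWithin_mono (Set.subset_univ _) (circleMap_preimage_codiscrete hR h))

/-- Poisson's formula on the circle of radius R: the two kernels differ by the real part of
2z(w−w')/((z−w)(z−w')), whose denominator is at least (R−ρ)² in modulus. -/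
theorem InnerProductSpace.HarmonicOnNhd.abs_sub_le {H : ℂ → ℝ} {R ρ : ℝ} {w w' : ℂ}
    (hH : InnerProductSpace.HarmonicOnNhd H (Metric.closedBall 0 R)) (hρ : ρ < R) (hw : ‖w‖ ≤ ρ)
    (hw' : ‖w'‖ ≤ ρ) :
    |H w - H w'| ≤ 2 * R * ‖w - w'‖ / (R - ρ) ^ 2 * Real.circleAverage (fun z => |H z|) 0 R := by
  have hR : 0 < R := (norm_nonneg w).trans_lt (hw.trans_lt hρ)
  have hb : w ∈ Metric.ball (0 : ℂ) R := by simpa using hw.trans_lt hρ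
  have hb' : w' ∈ Metric.ball (0 : ℂ) R := by simpa using hw'.trans_lt hρ
  have hHi : CircleIntegrable H 0 R := by
    refine ContinuousOn.circleIntegrable hR.le fun z hz => ?_
    exact (hH z (Metric.sphere_subset_closedBall hz)).1.continuousAt.continuousWithinAt
  have hki : ∀ v ∈ Metric.ball (0 : ℂ) R, CircleIntegrable
      ((Complex.re ∘ herglotzRieszKernel 0 v) • H) 0 R := fun v hv => by
    refine hHi.continuousOn_smul ?_
    exact Complex.continuous_re.comp_continuousOn (continuousOn_herglotzRieszKernel_sphere hv)
  rw [← hH.circleAverage_re_herglotzRieszKernel_smul hb,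
    ← hH.circleAverage_re_herglotzRieszKernel_smul hb',
    ← Real.circleAverage_sub (hki w hb) (hki w' hb')]
  refine Real.abs_circleAverage_le_circleAverage_abs.trans ?_
  rw [← smul_eq_mul, ← Real.circleAverage_fun_smul]
  refine Real.circleAverage_mono ((hki w hb).sub (hki w' hb')).abs (hHi.abs.const_smul) fun z hz => ?_
  rw [abs_of_pos hR] at hz
  have hz' : ‖z‖ = R := by simpa using hz
  have d1 : R - ρ ≤ ‖z - w‖ := by linarith [norm_sub_norm_le z w]
  have d2 : R - ρ ≤ ‖z - w'‖ := by linarith [norm_sub_norm_le z w']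
  have p : 0 < R - ρ := sub_pos.2 hρ
  have n1 : z - w ≠ 0 := norm_pos_iff.1 (p.trans_le d1)
  have n2 : z - w' ≠ 0 := norm_pos_iff.1 (p.trans_le d2)
  have key : herglotzRieszKernel 0 w z - herglotzRieszKernel 0 w' z =
      2 * z * (w - w') / ((z - w) * (z - w')) := by
    simp only [herglotzRieszKernel_def, sub_zero]
    field_simp
    ring
  have : |(herglotzRieszKernel 0 w z).re - (herglotzRieszKernel 0 w' z).re| ≤
      2 * R * ‖w - w'‖ / (R - ρ) ^ 2 := by
    rw [← Complex.sub_re, key]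
    refine (Complex.abs_re_le_norm _).trans ?_
    rw [norm_div, norm_mul, norm_mul, norm_mul, hz', Complex.norm_ofNat]
    gcongr
    rw [sq]
    gcongr
  simp only [Pi.abs_apply, Pi.sub_apply, smul_eq_mul, Pi.mul_apply, Function.comp_apply]
  rw [← sub_mul, abs_mul]
  gcongr

theorem intervalIntegrable_abs_sin_rpow (a b : ℝ) :
    IntervalIntegrable (fun θ => |Real.sin θ| ^ (-(1 / 2) : ℝ)) volume a b := by
  have hper : Function.Periodic (fun θ => |Real.sin θ| ^ (-(1 / 2) : ℝ)) Real.pi := fun θ => by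
    simp [Real.sin_add_pi]
  have hpos : IntervalIntegrable (fun θ => |Real.sin θ| ^ (-(1 / 2) : ℝ)) volume 0
      (Real.pi / 2) := by
    have h1 : IntervalIntegrable (fun θ : ℝ => (2 / Real.pi) ^ (-(1 / 2) : ℝ) *
        θ ^ (-(1 / 2) : ℝ)) volume 0 (Real.pi / 2) :=
      (intervalIntegral.intervalIntegrable_rpow' (by norm_num)).const_mul _
    refine h1.mono_fun (by fun_prop :
      Measurable fun θ => |Real.sin θ| ^ (-(1 / 2) : ℝ)).aestronglyMeasurable ?_
    filter_upwards [ae_restrict_mem measurableSet_uIoc] with θ hθ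
    rw [Set.uIoc_of_le (by positivity)] at hθ
    have h2 : 2 / Real.pi * θ ≤ |Real.sin θ| :=
      (Real.mul_le_sin hθ.1.le hθ.2).trans (le_abs_self _)
    have h3 : 0 < 2 / Real.pi * θ := mul_pos (by positivity) hθ.1
    rw [← Real.mul_rpow (by positivity) hθ.1.le, Real.norm_of_nonneg (by positivity),
      Real.norm_of_nonneg (by positivity)]
    exact Real.rpow_le_rpow_of_nonpos h3 h2 (by norm_num)
  have hneg : IntervalIntegrable (fun θ => |Real.sin θ| ^ (-(1 / 2) : ℝ)) volume
      (-(Real.pi / 2)) 0 := by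
    have := (IntervalIntegrable.iff_comp_neg (f := fun θ => |Real.sin θ| ^ (-(1 / 2) : ℝ))).1 hpos
    simpa using this.symm
  refine hper.intervalIntegrable Real.pi_ne_zero (t := -(Real.pi / 2)) ?_ a b
  have : -(Real.pi / 2) + Real.pi = Real.pi / 2 := by ring
  rw [this]
  exact hneg.trans hpos

/-- The mean value over a circle of radius `r` of `‖z - u‖ ^ (-1/2)` is `O(r ^ (-1/2))`, uniformly
in `u`. -/
theorem exists_circleAverage_norm_sub_rpow_le : ∃ C : ℝ, 0 ≤ C ∧ ∀ (r : ℝ) (u : ℂ), 0 < r →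
    CircleIntegrable (fun z => ‖z - u‖ ^ (-(1 / 2) : ℝ)) 0 r ∧
    Real.circleAverage (fun z => ‖z - u‖ ^ (-(1 / 2) : ℝ)) 0 r ≤ C * r ^ (-(1 / 2) : ℝ) := by
  set F : ℝ → ℝ := fun θ => |Real.sin θ| ^ (-(1 / 2) : ℝ) with hF
  refine ⟨(2 * Real.pi)⁻¹ * ∫ θ in 0..2 * Real.pi, F θ, ?_, fun r u hr => ?_⟩
  · refine mul_nonneg (by positivity) (intervalIntegral.integral_nonneg (by positivity) ?_)
    intro θ _
    positivity
  set φ := u.arg with hφ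
  have hper : Function.Periodic F (2 * Real.pi) := fun θ => by simp [hF, Real.sin_add_two_pi]
  have hFi : IntervalIntegrable (fun θ => r ^ (-(1 / 2) : ℝ) * F (θ - φ)) volume 0
      (2 * Real.pi) := by
    have := (intervalIntegrable_abs_sin_rpow (0 - φ) (2 * Real.pi - φ)).comp_sub_right φ
    simp only [sub_add_cancel] at this
    exact this.const_mul _
  have hle : ∀ θ, Real.sin (θ - φ) ≠ 0 →
      ‖circleMap 0 r θ - u‖ ^ (-(1 / 2) : ℝ) ≤ r ^ (-(1 / 2) : ℝ) * F (θ - φ) := by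
    intro θ hθ
    -- The distance to u is at least the distance to the line through 0 of direction φ, which
    -- contains u; rotation by −φ turns it into the real axis.
    have h1 : r * |Real.sin (θ - φ)| ≤ ‖circleMap 0 r θ - u‖ := by
      have e : ((circleMap 0 r θ - u) * Complex.exp (-(φ * Complex.I))).im =
          r * Real.sin (θ - φ) := by
        have e1 : circleMap 0 r θ * Complex.exp (-(φ * Complex.I)) =
            r * Complex.exp (((θ - φ : ℝ) : ℂ) * Complex.I) := by
          rw [circleMap_zero, mul_assoc, ← Complex.exp_add]
          congr 2
          push_cast
          ring
        have e2 : u * Complex.exp (-(φ * Complex.I)) = (‖u‖ : ℂ) := by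
          conv_lhs => rw [← Complex.norm_mul_exp_arg_mul_I u]
          rw [mul_assoc, ← Complex.exp_add, ← hφ, add_neg_cancel, Complex.exp_zero, mul_one]
        rw [sub_mul, e1, e2, Complex.sub_im, Complex.ofReal_im, sub_zero, Complex.im_ofReal_mul,
          Complex.exp_ofReal_mul_I_im]
      calc r * |Real.sin (θ - φ)| = |r * Real.sin (θ - φ)| := by rw [abs_mul, abs_of_pos hr]
        _ ≤ ‖(circleMap 0 r θ - u) * Complex.exp (-(φ * Complex.I))‖ := by
          rw [← e]; exact Complex.abs_im_le_norm _
        _ = ‖circleMap 0 r θ - u‖ := by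
          rw [norm_mul, ← neg_mul, ← Complex.ofReal_neg, Complex.norm_exp_ofReal_mul_I, mul_one]
    rw [hF]
    simp only
    rw [← Real.mul_rpow hr.le (abs_nonneg _)]
    exact Real.rpow_le_rpow_of_nonpos (mul_pos hr (abs_pos.2 hθ)) h1 (by norm_num)
  have hae : ∀ᵐ θ : ℝ, Real.sin (θ - φ) ≠ 0 := by
    have : {θ : ℝ | ¬ Real.sin (θ - φ) ≠ 0} ⊆ Set.range fun n : ℤ => n * Real.pi + φ := by
      intro θ hθ
      obtain ⟨n, hn⟩ := Real.sin_eq_zero_iff.1 (not_not.1 hθ)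
      exact ⟨n, by simp only [hn]; ring⟩
    exact ((Set.countable_range _).mono this).measure_zero _
  have hint : CircleIntegrable (fun z => ‖z - u‖ ^ (-(1 / 2) : ℝ)) 0 r := by
    refine IntervalIntegrable.mono_fun hFi ?_ ?_
    · exact (by fun_prop : Measurable fun θ => ‖circleMap 0 r θ - u‖ ^ (-(1 / 2) : ℝ)).aestronglyMeasurable
    · filter_upwards [ae_restrict_of_ae hae] with θ hθ
      rw [Real.norm_of_nonneg (by positivity), Real.norm_of_nonneg (by positivity)]
      exact hle θ hθ
  refine ⟨hint, ?_⟩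
  have h2 : ∫ θ in 0..2 * Real.pi, F (θ - φ) = ∫ θ in 0..2 * Real.pi, F θ := by
    rw [intervalIntegral.integral_comp_sub_right (fun θ => F θ)]
    have := hper.intervalIntegral_add_eq (0 - φ) 0
    rw [zero_add] at this
    rw [← this]
    congr 1
    ring
  rw [Real.circleAverage_def, smul_eq_mul, mul_assoc]
  refine mul_le_mul_of_nonneg_left ?_ (by positivity)
  rw [mul_comm (∫ θ in 0..2 * Real.pi, F θ), ← h2, ← intervalIntegral.integral_const_mul]
  refine intervalIntegral.integral_mono_ae (by positivity) hint hFi ?_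
  filter_upwards [hae] with θ hθ using hle θ hθ

/-- On the circle |log x| ≤ 2 log(2R) − log x for x = ‖z − u‖ ≤ 2R, and log ‖z − u‖ has mean log R.
-/
theorem circleAverage_abs_log_norm_sub_le {R : ℝ} (hR : 1 ≤ R) {u : ℂ} (hu : ‖u‖ ≤ R) :
    Real.circleAverage (fun z => |Real.log ‖z - u‖|) 0 R ≤ Real.log R + 2 * Real.log 2 := by
  have hR0 : 0 < R := by linarith
  have h1 := circleAverage_log_norm_sub_const_of_mem_closedBall (a := u) (c := 0) (R := R)
    (by simpa [abs_of_pos hR0] using hu)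
  have hi : CircleIntegrable (fun z => Real.log ‖z - u‖) 0 R := circleIntegrable_log_norm_sub_const R
  have h2 : Real.circleAverage (fun z => |Real.log ‖z - u‖|) 0 R ≤
      Real.circleAverage (fun z => 2 * Real.log (2 * R) - Real.log ‖z - u‖) 0 R := by
    refine Real.circleAverage_mono hi.abs ((circleIntegrable_const _ _ _).sub hi) fun z hz => ?_
    have hz' : ‖z‖ = R := by simpa [abs_of_pos hR0] using hz
    have h3 : ‖z - u‖ ≤ 2 * R := (norm_sub_le z u).trans (by linarith)
    have h0 : 0 ≤ Real.log (2 * R) := Real.log_nonneg (by linarith)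
    have h4 : Real.log ‖z - u‖ ≤ Real.log (2 * R) := by
      rcases (norm_nonneg (z - u)).eq_or_lt with h | h
      · rw [← h, Real.log_zero]; exact h0
      · exact Real.log_le_log h h3
    rw [abs_le]
    constructor <;> linarith
  rw [Real.circleAverage_fun_sub (circleIntegrable_const _ _ _) hi, Real.circleAverage_const, h1,
    Real.log_mul two_ne_zero hR0.ne'] at h2
  linarith

/-! ### The logarithmic counting function as a finite sum -/

/-- Any finite set containing the support in the disc will do, since points outside the disc have
weight 0. The origin needs no separate term because `Real.log 0 = 0`. -/
theorem logCounting_eq_sum (D : Function.locallyFinsupp ℂ ℤ) {r : ℝ} (hr : 1 ≤ r) (S : Finset ℂ)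
    (hS : ∀ z, ‖z‖ ≤ r → D z ≠ 0 → z ∈ S) :
    Function.locallyFinsuppWithin.logCounting D r =
      ∑ z ∈ S, (D z : ℝ) * max 0 (Real.log r - Real.log ‖z‖) := by
  have hr0 : 0 < r := by linarith
  have hmem : ∀ z : ℂ, z ∈ Metric.closedBall (0 : ℂ) |r| ↔ ‖z‖ ≤ r := fun z => by
    rw [abs_of_pos hr0, mem_closedBall_zero_iff]
  have h0 : (D 0 : ℝ) * Real.log r = ∑ z ∈ S, if z = 0 then (D 0 : ℝ) * Real.log r else 0 := by
    by_cases h : D 0 = 0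
    · simp [h]
    · rw [Finset.sum_ite_eq' S 0, if_pos (hS 0 (by simpa using hr0.le) h)]
  simp only [Function.locallyFinsuppWithin.logCounting, AddMonoidHom.coe_mk, ZeroHom.coe_mk]
  rw [finsum_eq_sum_of_support_subset (s := S), h0, ← Finset.sum_add_distrib]
  · refine Finset.sum_congr rfl fun z _ => ?_
    by_cases hz : z = 0
    · subst hz
      simp [max_eq_right (Real.log_nonneg hr)]
    have hz0 : 0 < ‖z‖ := norm_pos_iff.2 hz
    rw [if_neg hz, add_zero]
    by_cases hzr : ‖z‖ ≤ r
    · rw [Function.locallyFinsuppWithin.toClosedBall_eval_within _ ((hmem z).2 hzr),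
        Real.log_mul hr0.ne' (inv_ne_zero hz0.ne'), Real.log_inv, ← sub_eq_add_neg, max_eq_right]
      exact sub_nonneg.2 (Real.log_le_log hz0 hzr)
    · rw [Function.locallyFinsuppWithin.apply_eq_zero_of_notMem _ (mt (hmem z).1 hzr), max_eq_left]
      · simp
      · exact sub_nonpos.2 (Real.log_le_log hr0 (not_le.1 hzr).le)
  · intro z hz
    have h1 : Function.locallyFinsuppWithin.toClosedBall r D z ≠ 0 := fun h => by
      simp [h] at hz
    have h2 : ‖z‖ ≤ r := (hmem z).1 (by
      by_contra h
      exact h1 (Function.locallyFinsuppWithin.apply_eq_zero_of_notMem _ h))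
    rw [Function.locallyFinsuppWithin.toClosedBall_eval_within _ ((hmem z).2 h2)] at h1
    exact hS z h2 h1

theorem Function.locallyFinsupp.exists_finset_closedBall (D : Function.locallyFinsupp ℂ ℤ) (r : ℝ) :
    ∃ S : Finset ℂ, ∀ z, z ∈ S ↔ ‖z‖ ≤ r ∧ D z ≠ 0 := by
  have h := D.locallyFiniteSupport.finite_inter_support_of_isCompact
    (isCompact_closedBall (0 : ℂ) r)
  exact ⟨h.toFinset, fun z => by simp⟩

theorem sum_mul_log_div_le_logCounting {D : Function.locallyFinsupp ℂ ℤ} (hD : 0 ≤ D) {R R' : ℝ}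
    (hR : 1 ≤ R) (hRR' : R ≤ R') (S : Finset ℂ) (hS : ∀ z ∈ S, ‖z‖ ≤ R) :
    (∑ z ∈ S, (D z : ℝ)) * Real.log (R' / R) ≤
      Function.locallyFinsuppWithin.logCounting D R' := by
  classical
  obtain ⟨S', hS'⟩ := D.exists_finset_closedBall R'
  have hD' : ∀ z, (0 : ℝ) ≤ D z := fun z => by exact_mod_cast hD z
  rw [logCounting_eq_sum D (hR.trans hRR') (S ∪ S') fun z h1 h2 =>
    Finset.mem_union_right _ ((hS' z).2 ⟨h1, h2⟩), Finset.sum_mul]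
  refine (Finset.sum_le_sum fun z hz => ?_).trans (Finset.sum_le_sum_of_subset_of_nonneg
    Finset.subset_union_left fun z _ _ => mul_nonneg (hD' z) (le_max_left _ _))
  refine mul_le_mul_of_nonneg_left (le_max_of_le_right ?_) (hD' z)
  rw [Real.log_div (by linarith) (by linarith)]
  rcases (norm_nonneg z).eq_or_lt with h | h
  · rw [← h, Real.log_zero]
    linarith [Real.log_nonneg hR]
  · linarith [Real.log_le_log h (hS z hz)]

/-- A point u has weight log⁺(r/|u−c|) on the left and log⁺((r+|c|)/|u|) on the right. For large |u|
the first is at most A times the second; the finitely many other points produce C. -/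
theorem logCounting_comp_add_le {D D' : Function.locallyFinsupp ℂ ℤ} (hD : 0 ≤ D) {c : ℂ}
    (hD' : ∀ z, D' z = D (z + c)) {A : ℝ} (hA : 1 < A) : ∃ C : ℝ, ∀ r, 1 ≤ r →
    Function.locallyFinsuppWithin.logCounting D' r ≤
      A * Function.locallyFinsuppWithin.logCounting D (r + ‖c‖) + C := by
  classical
  set k := ‖c‖ with hk
  have hk0 : 0 ≤ k := norm_nonneg c
  have hDz : ∀ z, (0 : ℝ) ≤ D z := fun z => by exact_mod_cast hD z
  set R₀ := k + 1 + k / (A - 1) with hR₀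
  have hA1 : 0 < A - 1 := sub_pos.2 hA
  have hdiv : 0 ≤ k / (A - 1) := div_nonneg hk0 hA1.le
  obtain ⟨S₀, hS₀⟩ := D.exists_finset_closedBall R₀
  set B : ℂ → ℝ := fun u => |Real.log ‖u - c‖| + |Real.log ‖u‖| with hB
  have hB0 : ∀ u, 0 ≤ B u := fun u => by positivity
  refine ⟨∑ u ∈ S₀, D u * B u, fun r hr => ?_⟩
  obtain ⟨S, hS⟩ := D.exists_finset_closedBall (r + k)
  have hinj : Set.InjOn (fun u : ℂ => u - c) (S ∪ S₀ : Finset ℂ) := fun a _ b _ h => by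
    simpa using h
  have e1 : Function.locallyFinsuppWithin.logCounting D' r =
      ∑ u ∈ S ∪ S₀, (D u : ℝ) * max 0 (Real.log r - Real.log ‖u - c‖) := by
    rw [logCounting_eq_sum D' hr ((S ∪ S₀).image fun u => u - c), Finset.sum_image hinj]
    · exact Finset.sum_congr rfl fun u _ => by rw [hD', sub_add_cancel]
    · intro z h1 h2
      refine Finset.mem_image.2 ⟨z + c, Finset.mem_union_left _ ((hS _).2 ⟨?_, ?_⟩), by simp⟩
      · exact (norm_add_le _ _).trans (by linarith)
      · rwa [← hD']
  have e2 := logCounting_eq_sum D (r := r + k) (by linarith) (S ∪ S₀) fun z h1 h2 =>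
    Finset.mem_union_left _ ((hS z).2 ⟨h1, h2⟩)
  have e3 : ∑ u ∈ S₀, (D u : ℝ) * B u = ∑ u ∈ S ∪ S₀, if u ∈ S₀ then (D u : ℝ) * B u else 0 := by
    rw [Finset.sum_ite_mem, Finset.inter_eq_right.2 Finset.subset_union_right]
  rw [e1, e2, e3, Finset.mul_sum, ← Finset.sum_add_distrib]
  refine Finset.sum_le_sum fun u hu => ?_
  have hmon : Real.log r ≤ Real.log (r + k) := Real.log_le_log (by linarith) (by linarith)
  have hmax : max 0 (Real.log (r + k) - Real.log ‖u‖) ≤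
      A * max 0 (Real.log (r + k) - Real.log ‖u‖) :=
    le_mul_of_one_le_left (le_max_left _ _) hA.le
  split_ifs with hu₀
  · have : max 0 (Real.log r - Real.log ‖u - c‖) ≤
        A * max 0 (Real.log (r + k) - Real.log ‖u‖) + B u := by
      refine max_le ?_ ?_
      · have := le_max_left 0 (Real.log (r + k) - Real.log ‖u‖)
        have := hB0 u
        linarith
      · have h1 := le_max_right 0 (Real.log (r + k) - Real.log ‖u‖)
        have h2 := neg_abs_le (Real.log ‖u - c‖)
        have h3 := le_abs_self (Real.log ‖u‖)
        simp only [hB]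
        linarith
    nlinarith [hDz u]
  · rw [add_zero]
    by_cases hDu : D u = 0
    · simp [hDu]
    have hu1 : R₀ < ‖u‖ := by
      by_contra! h
      exact hu₀ ((hS₀ u).2 ⟨h, hDu⟩)
    suffices max 0 (Real.log r - Real.log ‖u - c‖) ≤
        A * max 0 (Real.log (r + k) - Real.log ‖u‖) by nlinarith [hDz u]
    refine max_le (mul_nonneg (by linarith) (le_max_left _ _)) ?_
    set y := ‖u‖ - k with hy
    have hy1 : 1 + k / (A - 1) < y := by linarith
    have hy0 : 0 < y := by linarith
    have hyc : y ≤ ‖u - c‖ := norm_sub_norm_le u c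
    have hAy : y + k ≤ A * y := by
      have : k ≤ (A - 1) * y := by
        have : k / (A - 1) ≤ y := by linarith
        rwa [div_le_iff₀ hA1, mul_comm] at this
      linarith
    have h1 : Real.log r - Real.log ‖u - c‖ ≤ Real.log (r / y) := by
      rw [Real.log_div (by linarith) hy0.ne']
      linarith [Real.log_le_log hy0 hyc]
    rcases le_total r y with hry | hry
    · have : Real.log (r / y) ≤ 0 :=
        Real.log_nonpos (by positivity) ((div_le_one hy0).2 hry)
      have := mul_nonneg (by linarith : 0 ≤ A) (le_max_left 0 (Real.log (r + k) - Real.log ‖u‖))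
      linarith
    -- Concavity of log: (r+k)/(y+k) is a convex combination of r/y and 1.
    have h2 : y / (y + k) * Real.log (r / y) ≤ Real.log (r + k) - Real.log ‖u‖ := by
      have hyk : 0 < y + k := by linarith
      have e : ‖u‖ = y + k := by rw [hy]; ring
      have hr0 : 0 < r / y := by positivity
      have := strictConcaveOn_log_Ioi.concaveOn.2 (Set.mem_Ioi.2 hr0) (Set.mem_Ioi.2 one_pos)
        (show 0 ≤ y / (y + k) by positivity) (show 0 ≤ k / (y + k) by positivity) (by field_simp)
      simp only [smul_eq_mul, Real.log_one, mul_zero, add_zero, mul_one] at this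
      rw [e, ← Real.log_div (by linarith) (by linarith)]
      rwa [show y / (y + k) * (r / y) + k / (y + k) = (r + k) / (y + k) by field_simp] at this
    have h3 : Real.log (r / y) ≤ A * (y / (y + k) * Real.log (r / y)) := by
      have hl : 0 ≤ Real.log (r / y) := Real.log_nonneg ((one_le_div hy0).2 hry)
      have : 1 ≤ A * (y / (y + k)) := by
        rw [← mul_div_assoc, one_le_div (by linarith)]
        exact hAy
      nlinarith
    have h4 := le_max_right 0 (Real.log (r + k) - Real.log ‖u‖)
    nlinarith

/-! ### The difference analogue of the lemma on the logarithmic derivative -/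

/-- Dividing out the zeros and poles in the disc leaves a zero-free analytic g, and H = log |g|. -/
theorem Meromorphic.exists_log_norm_eq_sum_add {h : ℂ → ℂ} (hh : Meromorphic h)
    (hne : ∀ z, meromorphicOrderAt h z ≠ ⊤) (R : ℝ) :
    ∃ (S : Finset ℂ) (H : ℂ → ℝ), (∀ u ∈ S, ‖u‖ ≤ R) ∧
      InnerProductSpace.HarmonicOnNhd H (Metric.closedBall 0 R) ∧
      ∀ᶠ z in codiscreteWithin (Metric.closedBall 0 R), Real.log ‖h z‖ =
        ∑ u ∈ S, (MeromorphicOn.divisor h Set.univ u : ℝ) * Real.log ‖z - u‖ + H z := by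
  set CB := Metric.closedBall (0 : ℂ) R
  have hm : MeromorphicOn h CB := fun z _ => hh z
  have hfin := (MeromorphicOn.divisor h CB).finiteSupport (isCompact_closedBall 0 R)
  obtain ⟨g, hg, hg0, hfg⟩ := hm.extract_zeros_poles (fun u => hne u) hfin
  have hmem : ∀ u, MeromorphicOn.divisor h CB u ≠ 0 → u ∈ CB := fun u hu => by
    by_contra hc
    exact hu (Function.locallyFinsuppWithin.apply_eq_zero_of_notMem _ hc)
  refine ⟨hfin.toFinset, fun z => Real.log ‖g z‖, fun u hu => ?_, fun z hz => ?_, ?_⟩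
  · simpa [CB] using hmem u (by simpa using hu)
  · exact (hg z hz).harmonicAt_log_norm (hg0 ⟨z, hz⟩)
  · filter_upwards [MeromorphicOn.extract_zeros_poles_log hg0 hfg] with z hz
    rw [hz, finsum_eq_sum_of_support_subset (s := hfin.toFinset)]
    · simp only [Pi.add_apply, Finset.sum_apply]
      congr 1
      refine Finset.sum_congr rfl fun u hu => ?_
      have hu' : u ∈ CB := hmem u (by simpa using hu)
      rw [MeromorphicOn.divisor_apply hm hu',
        MeromorphicOn.divisor_apply (fun z _ => hh z) (Set.mem_univ u)]
    · intro u hu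
      simp only [Set.Finite.coe_toFinset, Function.mem_support]
      intro h0
      apply hu
      ext z
      simp [h0]

theorem Real.log_one_add_le_two_mul_sqrt {x : ℝ} (hx : 0 ≤ x) : Real.log (1 + x) ≤ 2 * √x := by
  have h1 : 1 + x ≤ (1 + √x) ^ 2 := by nlinarith [Real.sq_sqrt hx, Real.sqrt_nonneg x]
  calc Real.log (1 + x) ≤ Real.log ((1 + √x) ^ 2) := Real.log_le_log (by linarith) h1
    _ = 2 * Real.log (1 + √x) := by rw [Real.log_pow]; norm_num
    _ ≤ 2 * √x := by linarith [Real.log_le_sub_one_of_pos (show 0 < 1 + √x by positivity)]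

/-- Using log(1+x) ≤ 2√x instead of log(1+x) ≤ x replaces the singularity ‖w‖⁻¹ by ‖w‖^(−1/2), which
is integrable on circles through 0. -/
theorem log_norm_add_sub_log_norm_le {w c : ℂ} (hw : w ≠ 0) (hwc : w + c ≠ 0) :
    Real.log ‖w + c‖ - Real.log ‖w‖ ≤ 2 * √‖c‖ * ‖w‖ ^ (-(1 / 2) : ℝ) := by
  have hw0 : 0 < ‖w‖ := norm_pos_iff.2 hw
  have hc0 : 0 < ‖w + c‖ := norm_pos_iff.2 hwc
  rw [← Real.log_div hc0.ne' hw0.ne']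
  calc Real.log (‖w + c‖ / ‖w‖) ≤ Real.log (1 + ‖c‖ / ‖w‖) := by
        apply Real.log_le_log (by positivity)
        rw [div_le_iff₀ hw0, add_mul, div_mul_cancel₀ _ hw0.ne', one_mul]
        exact norm_add_le _ _
    _ ≤ 2 * √(‖c‖ / ‖w‖) := Real.log_one_add_le_two_mul_sqrt (by positivity)
    _ = _ := by
        rw [Real.sqrt_div (norm_nonneg c), Real.rpow_neg hw0.le, ← Real.sqrt_eq_rpow]
        ring

theorem abs_log_norm_add_sub_log_norm_le {w c : ℂ} (hw : w ≠ 0) (hwc : w + c ≠ 0) :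
    |Real.log ‖w + c‖ - Real.log ‖w‖| ≤
      2 * √‖c‖ * (‖w‖ ^ (-(1 / 2) : ℝ) + ‖w + c‖ ^ (-(1 / 2) : ℝ)) := by
  have h1 := log_norm_add_sub_log_norm_le hw hwc
  have h2 := log_norm_add_sub_log_norm_le (c := -c) hwc (by simpa using hw)
  rw [add_neg_cancel_right, norm_neg] at h2
  have p1 : 0 ≤ 2 * √‖c‖ * ‖w‖ ^ (-(1 / 2) : ℝ) := by positivity
  have p2 : 0 ≤ 2 * √‖c‖ * ‖w + c‖ ^ (-(1 / 2) : ℝ) := by positivity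
  rw [abs_le]
  constructor <;> linarith

theorem eventually_nhdsNE_of_codiscreteWithin_closedBall {p : ℂ → Prop} {R : ℝ}
    (hp : ∀ᶠ z in codiscreteWithin (Metric.closedBall (0 : ℂ) R), p z) {x : ℂ} (hx : ‖x‖ < R) :
    ∀ᶠ z in 𝓝[≠] x, p z := by
  have h1 := mem_codiscreteWithin_iff_forall_mem_nhdsNE.1 hp x (by simpa using hx.le)
  have h2 : Metric.closedBall (0 : ℂ) R ∈ 𝓝[≠] x :=
    mem_nhdsWithin_of_mem_nhds (Metric.closedBall_mem_nhds_of_mem (by simpa using hx))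
  filter_upwards [h1, h2] with z hz hzR
  exact hz.resolve_right fun h => h hzR

theorem tendsto_add_right_nhdsNE (x c : ℂ) : Tendsto (fun z => z + c) (𝓝[≠] x) (𝓝[≠] (x + c)) := by
  refine tendsto_nhdsWithin_of_tendsto_nhds_of_eventually_within _ ?_ ?_
  · exact ((continuous_add_const c).tendsto x).mono_left nhdsWithin_le_nhds
  · filter_upwards [self_mem_nhdsWithin] with z hz
    simpa using hz

/-- In the decomposition of log |h|, the harmonic part changes little under the shift because its
kernel does, and each zero or pole contributes O(r^(−1/2)) in the mean. -/
theorem exists_proximity_shift_div_le {h : ℂ → ℂ} (hh : Meromorphic h)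
    (hne : ∀ z, meromorphicOrderAt h z ≠ ⊤) (c : ℂ) : ∃ C : ℝ, 0 ≤ C ∧
    ∀ r R : ℝ, 0 < r → 1 ≤ R → r + ‖c‖ < R → ∃ S : Finset ℂ, (∀ u ∈ S, ‖u‖ ≤ R) ∧
      proximity (fun z => h (z + c) / h z) ⊤ r ≤ 2 * R * ‖c‖ / (R - (r + ‖c‖)) ^ 2 *
        (Real.circleAverage (fun z => |Real.log ‖h z‖|) 0 R +
          (∑ u ∈ S, |(MeromorphicOn.divisor h Set.univ u : ℝ)|) *
            (Real.log R + 2 * Real.log 2)) +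
        (∑ u ∈ S, |(MeromorphicOn.divisor h Set.univ u : ℝ)|) * (C * r ^ (-(1 / 2) : ℝ)) := by
  obtain ⟨C, hC0, hC⟩ := exists_circleAverage_norm_sub_rpow_le
  refine ⟨4 * √‖c‖ * C, by positivity, fun r R hr hR hrR => ?_⟩
  obtain ⟨S, H, hS, hH, hform⟩ := hh.exists_log_norm_eq_sum_add hne R
  set D := MeromorphicOn.divisor h Set.univ
  refine ⟨S, hS, ?_⟩
  have hR0 : 0 < R := by linarith
  have hHi : CircleIntegrable H 0 R := by
    refine ContinuousOn.circleIntegrable hR0.le fun z hz => ?_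
    exact (hH z (Metric.sphere_subset_closedBall hz)).1.continuousAt.continuousWithinAt
  have hhi : CircleIntegrable (fun z => Real.log ‖h z‖) 0 R :=
    MeromorphicOn.circleIntegrable_log_norm fun z _ => hh z
  have hhi' : CircleIntegrable (fun z => |Real.log ‖h z‖|) 0 R := hhi.abs
  have hmean : Real.circleAverage (fun z => |H z|) 0 R ≤
      Real.circleAverage (fun z => |Real.log ‖h z‖|) 0 R +
        (∑ u ∈ S, |(D u : ℝ)|) * (Real.log R + 2 * Real.log 2) := by
    have hsi : ∀ u ∈ S, CircleIntegrable (fun z => |(D u : ℝ)| * |Real.log ‖z - u‖|) 0 R :=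
      fun u _ => (circleIntegrable_log_norm_sub_const (a := u) R).abs.const_smul
    have hsi' := CircleIntegrable.sum S hsi
    rw [Finset.sum_fn] at hsi'
    calc Real.circleAverage (fun z => |H z|) 0 R
        ≤ Real.circleAverage (fun z => |Real.log ‖h z‖| +
            ∑ u ∈ S, |(D u : ℝ)| * |Real.log ‖z - u‖|) 0 R := by
          refine Real.circleAverage_mono_codiscreteWithin hHi.abs (hhi'.add hsi') hR0.ne' ?_
          rw [abs_of_pos hR0]
          filter_upwards [codiscreteWithin_mono Metric.sphere_subset_closedBall hform] with z hz
          have e : H z = Real.log ‖h z‖ - ∑ u ∈ S, (D u : ℝ) * Real.log ‖z - u‖ := by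
            rw [hz]; ring
          rw [e]
          refine (abs_sub _ _).trans ?_
          gcongr
          refine (Finset.abs_sum_le_sum_abs _ _).trans (Finset.sum_le_sum fun u _ => ?_)
          rw [abs_mul]
      _ = Real.circleAverage (fun z => |Real.log ‖h z‖|) 0 R +
            ∑ u ∈ S, |(D u : ℝ)| * Real.circleAverage (fun z => |Real.log ‖z - u‖|) 0 R := by
          rw [Real.circleAverage_fun_add hhi' hsi', Real.circleAverage_fun_sum hsi]
          congr 1
          simp only [← smul_eq_mul, Real.circleAverage_fun_smul]
      _ ≤ _ := by
          rw [Finset.sum_mul]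
          gcongr with u hu
          exact circleAverage_abs_log_norm_sub_le hR (hS u hu)
  set KH := 2 * R * ‖c‖ / (R - (r + ‖c‖)) ^ 2 * Real.circleAverage (fun z => |H z|) 0 R with hKH
  have hKHle : ∀ z, ‖z‖ = r → |H (z + c) - H z| ≤ KH := fun z hz => by
    have := hH.abs_sub_le (w := z + c) (w' := z) hrR ((norm_add_le _ _).trans (by linarith))
      (by linarith [norm_nonneg c])
    rwa [add_sub_cancel_left] at this
  set b : ℂ → ℂ → ℝ := fun u z => |(D u : ℝ)| * (2 * √‖c‖ *
    (‖z - u‖ ^ (-(1 / 2) : ℝ) + ‖z - (u - c)‖ ^ (-(1 / 2) : ℝ))) with hb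
  have hbi : ∀ u ∈ S, CircleIntegrable (b u) 0 r := fun u _ =>
    (((hC r u hr).1.add (hC r (u - c) hr).1).const_smul (a := 2 * √‖c‖)).const_smul
      (a := |(D u : ℝ)|)
  have hbi' := CircleIntegrable.sum S hbi
  rw [Finset.sum_fn] at hbi'
  have hq : Meromorphic fun z => h (z + c) / h z :=
    fun z =>
    (Meromorphic.meromorphic_fun_comp_add_const_iff_meromorphic.2 hh z).div (hh z)
  have hbavg : ∀ u ∈ S, Real.circleAverage (b u) 0 r ≤
      |(D u : ℝ)| * (4 * √‖c‖ * C * r ^ (-(1 / 2) : ℝ)) := fun u _ => by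
    have e : Real.circleAverage (b u) 0 r = |(D u : ℝ)| * (2 * √‖c‖ *
        (Real.circleAverage (fun z => ‖z - u‖ ^ (-(1 / 2) : ℝ)) 0 r +
          Real.circleAverage (fun z => ‖z - (u - c)‖ ^ (-(1 / 2) : ℝ)) 0 r)) := by
      rw [← Real.circleAverage_fun_add (hC r u hr).1 (hC r (u - c) hr).1]
      simp only [← smul_eq_mul, ← Real.circleAverage_fun_smul]
      rfl
    rw [e]
    have h1 := (hC r u hr).2
    have h2 := (hC r (u - c) hr).2
    refine mul_le_mul_of_nonneg_left ?_ (abs_nonneg _)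
    calc _ ≤ 2 * √‖c‖ * (C * r ^ (-(1 / 2) : ℝ) + C * r ^ (-(1 / 2) : ℝ)) := by gcongr
      _ = _ := by ring
  have hmain : ∀ᶠ z in codiscreteWithin (Metric.sphere (0 : ℂ) |r|),
      Real.posLog ‖h (z + c) / h z‖ ≤ KH + ∑ u ∈ S, b u z := by
    refine mem_codiscreteWithin_iff_forall_mem_nhdsNE.2 fun x hx => ?_
    have hxr : ‖x‖ = r := by simpa [abs_of_pos hr] using hx
    have hxc : ‖x + c‖ < R := (norm_add_le _ _).trans_lt (by rwa [hxr])
    have e1 := eventually_nhdsNE_of_codiscreteWithin_closedBall hform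
      (show ‖x‖ < R by linarith [norm_nonneg c])
    have e2 := (tendsto_add_right_nhdsNE x c).eventually
      (eventually_nhdsNE_of_codiscreteWithin_closedBall hform hxc)
    have e3 : ∀ y : ℂ, ∀ᶠ z in 𝓝[≠] y, z ∉ S := fun y => by
      have := (S.finite_toSet.subset (Set.sdiff_subset (t := {y}))).isClosed.isOpen_compl.mem_nhds
        (show y ∈ ((S : Set ℂ) \ {y})ᶜ by simp)
      filter_upwards [mem_nhdsWithin_of_mem_nhds this, self_mem_nhdsWithin] with z h1 h2 h3
      exact h1 ⟨h3, h2⟩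
    filter_upwards [e1, e2, e3 x, (tendsto_add_right_nhdsNE x c).eventually (e3 (x + c))]
      with z h1 h2 h3 h4
    by_cases hz : z ∈ Metric.sphere (0 : ℂ) |r|
    swap
    · exact Or.inr hz
    left
    have hzr : ‖z‖ = r := by simpa [abs_of_pos hr] using hz
    show Real.posLog ‖h (z + c) / h z‖ ≤ KH + ∑ u ∈ S, b u z
    have hsum0 : 0 ≤ ∑ u ∈ S, b u z := Finset.sum_nonneg fun u _ => by positivity
    have hK0 : 0 ≤ KH := (abs_nonneg _).trans (hKHle z hzr)
    -- If h vanishes at z or z+c, the quotient is 0 (by `x / 0 = 0` in the first case), and so is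
    -- its log⁺.
    by_cases hz0 : h z = 0
    · simpa [hz0] using add_nonneg hK0 hsum0
    by_cases hzc0 : h (z + c) = 0
    · simpa [hzc0] using add_nonneg hK0 hsum0
    have hlog : Real.log ‖h (z + c) / h z‖ = (H (z + c) - H z) +
        ∑ u ∈ S, (D u : ℝ) * (Real.log ‖z - u + c‖ - Real.log ‖z - u‖) := by
      rw [norm_div, Real.log_div (norm_ne_zero_iff.2 hzc0) (norm_ne_zero_iff.2 hz0), h1, h2]
      simp only [mul_sub, Finset.sum_sub_distrib]
      have : ∀ u, z + c - u = z - u + c := fun u => by ring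
      simp only [this]
      ring
    have hle : |Real.log ‖h (z + c) / h z‖| ≤ KH + ∑ u ∈ S, b u z := by
      rw [hlog]
      refine (abs_add_le _ _).trans (add_le_add (hKHle z hzr) ?_)
      refine (Finset.abs_sum_le_sum_abs _ _).trans (Finset.sum_le_sum fun u hu => ?_)
      rw [abs_mul]
      refine mul_le_mul_of_nonneg_left ?_ (abs_nonneg _)
      have n1 : z - u ≠ 0 := sub_ne_zero.2 fun e => h3 (e ▸ hu)
      have n2 : z - u + c ≠ 0 := fun e => h4 (by
        have : z + c = u := by linear_combination e
        rwa [this])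
      have := abs_log_norm_add_sub_log_norm_le n1 n2
      rwa [show z - u + c = z - (u - c) by ring] at this ⊢
    rw [Real.posLog_def]
    exact max_le (add_nonneg hK0 hsum0) ((le_abs_self _).trans hle)
  calc proximity (fun z => h (z + c) / h z) ⊤ r
      = Real.circleAverage (fun z => Real.posLog ‖h (z + c) / h z‖) 0 r := by
        rw [proximity_top]
    _ ≤ Real.circleAverage (fun z => KH + ∑ u ∈ S, b u z) 0 r :=
        Real.circleAverage_mono_codiscreteWithin
          (MeromorphicOn.circleIntegrable_posLog_norm fun z _ => hq z)
          ((circleIntegrable_const _ _ _).add hbi') hr.ne' hmain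
    _ = KH + ∑ u ∈ S, Real.circleAverage (b u) 0 r := by
        rw [Real.circleAverage_fun_add (circleIntegrable_const _ _ _) hbi',
          Real.circleAverage_const, Real.circleAverage_fun_sum hbi]
    _ ≤ _ := by
        rw [Finset.sum_mul S _ (4 * √‖c‖ * C * _)]
        refine add_le_add ?_ (Finset.sum_le_sum hbavg)
        rw [hKH]
        gcongr

theorem exists_characteristic_inv_le {h : ℂ → ℂ} (hh : Meromorphic h) :
    ∃ M : ℝ, ∀ r, |characteristic h ⊤ r - characteristic h⁻¹ ⊤ r| ≤ M :=
  ⟨_, fun _ => characteristic_sub_characteristic_inv_le hh⟩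

theorem proximity_le_characteristic (h : ℂ → ℂ) {r : ℝ} (hr : 1 ≤ r) :
    proximity h ⊤ r ≤ characteristic h ⊤ r :=
  le_add_of_nonneg_right (logCounting_nonneg hr)

theorem logCounting_le_characteristic (h : ℂ → ℂ) (a : WithTop ℂ) (r : ℝ) :
    logCounting h a r ≤ characteristic h a r :=
  le_add_of_nonneg_left (proximity_nonneg r)

theorem circleAverage_abs_log_norm_le {h : ℂ → ℂ} (hh : Meromorphic h) {r : ℝ} (hr : 1 ≤ r) :
    Real.circleAverage (fun z => |Real.log ‖h z‖|) 0 r ≤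
      characteristic h ⊤ r + characteristic h⁻¹ ⊤ r := by
  refine le_trans (le_of_eq ?_) (add_le_add (proximity_le_characteristic h hr)
    (proximity_le_characteristic h⁻¹ hr))
  rw [proximity_top, proximity_top, ← Real.circleAverage_fun_add
    (MeromorphicOn.circleIntegrable_posLog_norm fun z _ => hh z)
    (MeromorphicOn.circleIntegrable_posLog_norm fun z _ => (hh z).inv)]
  congr 1
  ext z
  rw [Pi.inv_apply, norm_inv]
  have h1 := Real.posLog_sub_posLog_inv (x := ‖h z‖)
  have h2 := Real.half_mul_log_add_log_abs (x := ‖h z‖)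
  linarith

theorem sum_abs_divisor_mul_log_div_le {h : ℂ → ℂ} {R R' : ℝ} (hR : 1 ≤ R) (hRR' : R ≤ R')
    (S : Finset ℂ) (hS : ∀ z ∈ S, ‖z‖ ≤ R) :
    (∑ z ∈ S, |(MeromorphicOn.divisor h Set.univ z : ℝ)|) * Real.log (R' / R) ≤
      characteristic h ⊤ R' + characteristic h⁻¹ ⊤ R' := by
  set D := MeromorphicOn.divisor h Set.univ
  have h1 := sum_mul_log_div_le_logCounting (posPart_nonneg D) hR hRR' S hS
  have h2 := sum_mul_log_div_le_logCounting (negPart_nonneg D) hR hRR' S hS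
  have e : ∑ z ∈ S, |(D z : ℝ)| = ∑ z ∈ S, ((D⁺ z : ℤ) : ℝ) + ∑ z ∈ S, ((D⁻ z : ℤ) : ℝ) := by
    rw [← Finset.sum_add_distrib]
    refine Finset.sum_congr rfl fun z _ => ?_
    rw [Function.locallyFinsuppWithin.posPart_apply, Function.locallyFinsuppWithin.negPart_apply,
      ← Int.cast_add, posPart_add_negPart, Int.cast_abs]
  rw [e, add_mul]
  rw [← logCounting_zero, ← logCounting_inv] at h1
  rw [← logCounting_top] at h2
  linarith [logCounting_le_characteristic h ⊤ R', logCounting_le_characteristic h⁻¹ ⊤ R']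

/-- With s = r^(3/4), R = r + s and R' = r + 2s, the kernel factor is O(r^(−1/2)) and n(R) log(R'/R)
= O(T(r)) gives n(R) = O(r^(1/4) T(r)). The total is O(r^(−1/4) log r) T(r). -/
theorem isLittleO_proximity_shift_div {h : ℂ → ℂ} (hh : Meromorphic h)
    (hne : ∀ z, meromorphicOrderAt h z ≠ ⊤) (hT : Tendsto (characteristic h ⊤) atTop atTop)
    {K : ℝ} (hK : ∀ᶠ r in atTop, characteristic h ⊤ r ≤ r ^ K) (c : ℂ) :
    proximity (fun z => h (z + c) / h z) ⊤ =o[logMeasureFilter] characteristic h ⊤ := by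
  obtain ⟨C, hC0, hC⟩ := exists_proximity_shift_div_le hh hne c
  obtain ⟨M, hM⟩ := exists_characteristic_inv_le hh
  set T := characteristic h ⊤ with hTdef
  set e : ℝ → ℝ := fun r => 16 * ‖c‖ * (5 * r ^ (-(1 / 2) : ℝ) +
    15 * (r ^ (-(1 / 4) : ℝ) * (Real.log r + 3 * Real.log 2))) +
    15 * C * r ^ (-(1 / 4) : ℝ) with he
  have hrpow : ∀ s : ℝ, 0 < s → Tendsto (fun r : ℝ => r ^ (-s)) atTop (𝓝 0) := fun s hs =>
    tendsto_rpow_neg_atTop hs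
  have hlogr : Tendsto (fun r : ℝ => r ^ (-(1 / 4) : ℝ) * (Real.log r + 3 * Real.log 2)) atTop
      (𝓝 0) := by
    have h1 : Tendsto (fun r : ℝ => Real.log r / r ^ (1 / 4 : ℝ)) atTop (𝓝 0) :=
      (isLittleO_log_rpow_atTop (by norm_num)).tendsto_div_nhds_zero
    have h2 := h1.add ((hrpow (1 / 4) (by norm_num)).mul_const (3 * Real.log 2))
    rw [zero_mul, add_zero] at h2
    refine h2.congr' ?_
    filter_upwards [eventually_gt_atTop 0] with r hr
    rw [Real.rpow_neg hr.le]
    ring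
  have he0 : Tendsto e atTop (𝓝 0) := by
    have := ((((hrpow (1 / 2) (by norm_num)).const_mul 5).add (hlogr.const_mul 15)).const_mul
      (16 * ‖c‖)).add ((hrpow (1 / 4) (by norm_num)).const_mul (15 * C))
    simp only [mul_zero, add_zero] at this
    exact this
  have hgrow := (characteristic_monotoneOn hh).eventually_le_mul (hT.eventually_ge_atTop 1) hK
    (show (1 : ℝ) < 2 by norm_num)
  have hs : Tendsto (fun r : ℝ => r ^ (3 / 4 : ℝ)) atTop atTop := tendsto_rpow_atTop (by norm_num)
  have hbound : ∀ᶠ r in logMeasureFilter,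
      proximity (fun z => h (z + c) / h z) ⊤ r ≤ e r * T r := by
    filter_upwards [hgrow, logMeasureFilter_le_atTop (eventually_ge_atTop 1),
      logMeasureFilter_le_atTop (hT.eventually_ge_atTop M),
      logMeasureFilter_le_atTop (hs.eventually_ge_atTop (2 * ‖c‖)),
      logMeasureFilter_le_atTop (hT.eventually_ge_atTop 0)] with r h2T hr hMT hsr hT0
    set s := r ^ (3 / 4 : ℝ) with hsdef
    have hr0 : 0 < r := by linarith
    have hs1 : 1 ≤ s := Real.one_le_rpow hr (by norm_num)
    have hsr' : s ≤ r := by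
      have := Real.rpow_le_rpow_of_exponent_le hr (show (3 / 4 : ℝ) ≤ 1 by norm_num)
      rwa [Real.rpow_one] at this
    obtain ⟨S, hS, hprox⟩ := hC r (r + s) hr0 (by linarith) (by linarith [norm_nonneg c])
    have hn := sum_abs_divisor_mul_log_div_le (h := h) (R := r + s) (R' := r + 2 * s)
      (by linarith) (by linarith) S hS
    set n := ∑ u ∈ S, |(MeromorphicOn.divisor h Set.univ u : ℝ)|
    have hn0 : 0 ≤ n := Finset.sum_nonneg fun _ _ => abs_nonneg _
    have hM1 := (abs_le.1 (hM (r + 2 * s))).1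
    have hM2 := (abs_le.1 (hM (r + s))).1
    have hmono : T (r + s) ≤ T (r + 2 * s) := characteristic_monotoneOn hh
      (Set.mem_Ioi.2 (by linarith)) (Set.mem_Ioi.2 (by linarith)) (by linarith)
    have hcirc := circleAverage_abs_log_norm_le hh (r := r + s) (by linarith)
    -- Both T(r+s, h) and T(r+s, 1/h) − M are at most 2T(r), and M ≤ T(r).
    have hcirc' : Real.circleAverage (fun z => |Real.log ‖h z‖|) 0 (r + s) ≤ 5 * T r := by
      linarith
    have hlogge : s / (3 * r) ≤ Real.log ((r + 2 * s) / (r + s)) := by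
      have h1 := Real.one_sub_inv_le_log_of_pos (show 0 < (r + 2 * s) / (r + s) by positivity)
      refine le_trans ?_ h1
      rw [inv_div, one_sub_div (by positivity)]
      have : r + 2 * s - (r + s) = s := by ring
      rw [this]
      gcongr
      linarith
    have hq : 3 * r / s = 3 * r ^ (1 / 4 : ℝ) := by
      rw [hsdef, mul_div_assoc]
      congr 1
      nth_rewrite 1 [← Real.rpow_one r]
      rw [← Real.rpow_sub hr0]
      norm_num
    have hnle : n ≤ 15 * r ^ (1 / 4 : ℝ) * T r := by
      have h1 : n * (s / (3 * r)) ≤ 5 * T r :=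
        (mul_le_mul_of_nonneg_left hlogge hn0).trans (by linarith)
      have h2 : n ≤ 5 * T r * (3 * r / s) := by
        rw [← div_le_iff₀ (by positivity), div_div_eq_mul_div, mul_div_assoc]
        exact h1
      rw [hq] at h2
      linarith
    have hlogR : Real.log (r + s) + 2 * Real.log 2 ≤ Real.log r + 3 * Real.log 2 := by
      have : Real.log (r + s) ≤ Real.log (2 * r) := Real.log_le_log (by linarith) (by linarith)
      rw [Real.log_mul two_ne_zero hr0.ne'] at this
      linarith
    have hlog0 : 0 ≤ Real.log (r + s) + 2 * Real.log 2 :=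
      add_nonneg (Real.log_nonneg (by linarith)) (by positivity)
    have hfac : 2 * (r + s) * ‖c‖ / (r + s - (r + ‖c‖)) ^ 2 ≤
        16 * ‖c‖ * r ^ (-(1 / 2) : ℝ) := by
      have hs2 : r ^ (-(1 / 2) : ℝ) = r / s ^ 2 := by
        rw [hsdef, ← Real.rpow_natCast, ← Real.rpow_mul hr0.le]
        nth_rewrite 2 [← Real.rpow_one r]
        rw [← Real.rpow_sub hr0]
        norm_num
      calc 2 * (r + s) * ‖c‖ / (r + s - (r + ‖c‖)) ^ 2 ≤ 2 * (2 * r) * ‖c‖ / (s / 2) ^ 2 := by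
            gcongr <;> linarith
        _ = 16 * ‖c‖ * r ^ (-(1 / 2) : ℝ) := by
            rw [hs2]
            field_simp
            ring
    have hmul1 : r ^ (-(1 / 2) : ℝ) * r ^ (1 / 4 : ℝ) = r ^ (-(1 / 4) : ℝ) := by
      rw [← Real.rpow_add hr0]
      norm_num
    calc proximity (fun z => h (z + c) / h z) ⊤ r
        ≤ _ := hprox
      _ ≤ 16 * ‖c‖ * r ^ (-(1 / 2) : ℝ) * (5 * T r + 15 * r ^ (1 / 4 : ℝ) * T r *
            (Real.log r + 3 * Real.log 2)) +
          15 * r ^ (1 / 4 : ℝ) * T r * (C * r ^ (-(1 / 2) : ℝ)) := by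
          gcongr
          exact add_nonneg (Real.circleAverage_nonneg_of_nonneg fun _ _ => abs_nonneg _)
            (mul_nonneg hn0 hlog0)
      _ = e r * T r := by
          simp only [he]
          rw [← hmul1]
          ring
  refine Asymptotics.isLittleO_iff.2 fun ε hε => ?_
  filter_upwards [hbound, logMeasureFilter_le_atTop (he0.eventually (gt_mem_nhds hε)),
    logMeasureFilter_le_atTop (hT.eventually_ge_atTop 0)] with r h1 h2 h3
  rw [Real.norm_of_nonneg (proximity_nonneg r), Real.norm_of_nonneg h3]
  exact h1.trans (mul_le_mul_of_nonneg_right h2.le h3)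

/-! ### Identity of meromorphic functions -/

theorem eventually_codiscrete_iff {p : ℂ → Prop} :
    (∀ᶠ z in codiscrete ℂ, p z) ↔ ∀ x, ∀ᶠ z in 𝓝[≠] x, p z := by
  refine mem_codiscreteWithin_iff_forall_mem_nhdsNE.trans ?_
  simp only [Set.mem_univ, forall_true_left, Set.compl_univ, Set.union_empty]
  rfl

theorem meromorphicEq_iff {F G : ℂ → ℂ} :
    MeromorphicEq F G ↔ ∀ z, meromorphicOrderAt (fun w => F w - G w) z = ⊤ := by
  simp only [MeromorphicEq, EventuallyEq, eventually_codiscrete_iff, meromorphicOrderAt_eq_top_iff,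
    sub_eq_zero]

theorem meromorphicOrderAt_sub_ne_top {F G : ℂ → ℂ} (hF : Meromorphic F) (hG : Meromorphic G)
    (h : ¬ MeromorphicEq F G) (z : ℂ) : meromorphicOrderAt (fun w => F w - G w) z ≠ ⊤ := by
  have hm : Meromorphic fun w => F w - G w := fun x => (hF x).sub (hG x)
  rw [meromorphicEq_iff, not_forall] at h
  exact hm.exists_meromorphicOrderAt_ne_top_iff_forall.1 h z

theorem Meromorphic.shift {f : ℂ → ℂ} (hf : Meromorphic f) (c : ℂ) :
    Meromorphic fun z => f (z + c) :=
  Meromorphic.meromorphic_fun_comp_add_const_iff_meromorphic.2 hf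

theorem eventually_codiscrete_shift {p : ℂ → Prop} (hp : ∀ᶠ z in codiscrete ℂ, p z) (c : ℂ) :
    ∀ᶠ z in codiscrete ℂ, p (z + c) :=
  eventually_codiscrete_iff.2 fun x =>
    (tendsto_add_right_nhdsNE x c).eventually (eventually_codiscrete_iff.1 hp (x + c))

theorem MeromorphicEq.isPeriodicWith {c : ℂ} {f a : ℂ → ℂ} (h : MeromorphicEq f a)
    (ha : IsPeriodicWith c a) : IsPeriodicWith c f := by
  have h1 := eventually_codiscrete_shift h c
  filter_upwards [h, h1, ha] with z e1 e2 e3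
  rw [e1, e2, e3]

/-! ### The characteristic function -/

theorem proximity_neg_top (f : ℂ → ℂ) : proximity (-f) ⊤ = proximity f ⊤ := by
  simp [proximity_top]

theorem logCounting_neg_top {f : ℂ → ℂ} (hf : Meromorphic f) :
    logCounting (-f) ⊤ = logCounting f ⊤ := by
  rw [logCounting_top, logCounting_top]
  congr 2
  ext z
  rw [MeromorphicOn.divisor_apply (fun z _ => (hf z).neg) (Set.mem_univ z),
    MeromorphicOn.divisor_apply (fun z _ => hf z) (Set.mem_univ z), ← meromorphicOrderAt_neg]

theorem characteristic_neg_top {f : ℂ → ℂ} (hf : Meromorphic f) :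
    characteristic (-f) ⊤ = characteristic f ⊤ := by
  rw [characteristic, characteristic, proximity_neg_top, logCounting_neg_top hf]

theorem characteristic_sub_top_le {f g : ℂ → ℂ} (hf : Meromorphic f) (hg : Meromorphic g) {r : ℝ}
    (hr : 1 ≤ r) : characteristic (fun z => f z - g z) ⊤ r ≤
      characteristic f ⊤ r + characteristic g ⊤ r + Real.log 2 := by
  have := characteristic_add_top_le hf (fun z => (hg z).neg : Meromorphic (-g)) hr
  rw [characteristic_neg_top hg] at this
  exact (congrFun (congrArg (fun F => characteristic F ⊤) (sub_eq_add_neg f g)) r).trans_le this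

theorem IsFiniteOrderMeromorphic.exists_characteristic_le_rpow {f : ℂ → ℂ}
    (hf : IsFiniteOrderMeromorphic f) : ∃ K : ℝ, ∀ᶠ r in atTop, characteristic f ⊤ r ≤ r ^ K := by
  obtain ⟨K, hK1, -⟩ := EReal.lt_iff_exists_real_btwn.1 hf.2
  refine ⟨K, ?_⟩
  filter_upwards [eventually_lt_of_limsup_lt hK1, eventually_gt_atTop 1] with r hr hr1
  have hlog : 0 < Real.log r := Real.log_pos hr1
  have h1 : Real.posLog (characteristic f ⊤ r) < K * Real.log r := by
    rwa [EReal.coe_lt_coe_iff, div_lt_iff₀ hlog] at hr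
  rcases le_or_gt (characteristic f ⊤ r) 0 with h | h
  · exact h.trans (by positivity)
  · rw [← Real.log_le_log_iff h (by positivity), Real.log_rpow (by positivity)]
    exact (le_max_right _ _).trans h1.le

/-- A nonperiodic f is nonconstant, so f − f(z₀) has an isolated zero at z₀, and this alone forces
growth like log r. -/
theorem tendsto_characteristic_atTop {c : ℂ} {f : ℂ → ℂ} (hf : Meromorphic f)
    (hper : ¬ IsPeriodicWith c f) : Tendsto (characteristic f ⊤) atTop atTop := by
  classical
  obtain ⟨z₀, hz₀⟩ : ∃ z₀, AnalyticAt ℂ f z₀ := by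
    have h : ∀ᶠ z in codiscrete ℂ, AnalyticAt ℂ f z :=
      MeromorphicOn.analyticAt_mem_codiscreteWithin fun z _ => hf z
    exact ((eventually_codiscrete_iff.1 h) 0).exists
  set b := f z₀ with hb
  set g : ℂ → ℂ := fun z => f z - b with hg
  have hgm : Meromorphic g := fun z => (hf z).sub (.const b z)
  have hne : ∀ z, meromorphicOrderAt g z ≠ ⊤ := by
    refine meromorphicOrderAt_sub_ne_top hf (fun z => .const b z) fun h => hper ?_
    exact h.isPeriodicWith (EventuallyEq.refl _ _)
  have hord : 0 < meromorphicOrderAt g z₀ := by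
    rw [← tendsto_zero_iff_meromorphicOrderAt_pos (hgm z₀)]
    have : Tendsto g (𝓝 z₀) (𝓝 (g z₀)) := (hz₀.continuousAt.sub continuousAt_const)
    have h0 : g z₀ = 0 := by simp [hg, hb]
    rw [h0] at this
    exact this.mono_left nhdsWithin_le_nhds
  set D := MeromorphicOn.divisor g Set.univ with hD
  have hD1 : 1 ≤ D z₀ := by
    rw [hD, MeromorphicOn.divisor_apply (fun z _ => hgm z) (Set.mem_univ z₀)]
    lift meromorphicOrderAt g z₀ to ℤ using hne z₀ with n
    have : 0 < n := by simpa using hord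
    simpa using Int.add_one_le_of_lt this
  have hle : Function.locallyFinsuppWithin.single z₀ 1 ≤ D⁺ := fun z => by
    rw [Function.locallyFinsuppWithin.single_apply, Function.locallyFinsuppWithin.posPart_apply]
    split_ifs with h
    · rw [h]; exact hD1.trans (le_posPart _)
    · exact posPart_nonneg _
  obtain ⟨M, hM⟩ := exists_characteristic_inv_le hgm
  have hlow : ∀ᶠ r in atTop, Real.log r - Real.log ‖z₀‖ - M - (Real.posLog ‖b‖ + Real.log 2) ≤
      characteristic f ⊤ r := by
    filter_upwards [eventually_ge_atTop 1, eventually_ge_atTop ‖z₀‖] with r hr hrz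
    have h1 := Function.locallyFinsuppWithin.logCounting_le hle hr
    rw [Function.locallyFinsuppWithin.logCounting_single_eq_log_sub_const hrz, Int.cast_one, one_mul,
      ← logCounting_zero, ← logCounting_inv] at h1
    have h2 := logCounting_le_characteristic g⁻¹ ⊤ r
    have h3 := (abs_le.1 (hM r)).1
    have h4 := (abs_le.1 (abs_characteristic_sub_characteristic_shift_le hf (a₀ := b) (r := r))).1
    change _ ≤ characteristic f ⊤ r - characteristic g ⊤ r at h4
    linarith
  refine tendsto_atTop_mono' _ hlow ?_
  simp only [sub_eq_add_neg]
  exact tendsto_atTop_add_const_right _ _ (tendsto_atTop_add_const_right _ _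
    (tendsto_atTop_add_const_right _ _ Real.tendsto_log_atTop))

/-- Every [r, κr] contains a nonexceptional radius, and monotonicity carries the bound back to r.
This gives f − a the polynomial growth that the shift estimate requires. -/
theorem exists_characteristic_le_rpow_of_isLittleO {f a : ℂ → ℂ} (ha : Meromorphic a)
    (hsmall : characteristic a ⊤ =o[logMeasureFilter] characteristic f ⊤) {K : ℝ}
    (hK : ∀ᶠ r in atTop, characteristic f ⊤ r ≤ r ^ K) :
    ∃ K' : ℝ, ∀ᶠ r in atTop, characteristic a ⊤ r ≤ r ^ K' := by
  obtain ⟨E, hE, R, hR⟩ := eventually_logMeasureFilter.1 (hsmall.bound one_pos)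
  obtain ⟨κ, hκ, hE'⟩ := hE.exists_notMem
  obtain ⟨Q, hQ⟩ := eventually_atTop.1 hK
  refine ⟨2 * |K|, ?_⟩
  filter_upwards [eventually_ge_atTop R, eventually_ge_atTop Q, eventually_ge_atTop κ] with
    r h1 h2 h3
  have hr1 : 1 ≤ r := hκ.trans h3
  obtain ⟨s, hs, hsE⟩ := hE' r (by linarith)
  have hs0 : 0 < s := by linarith [hs.1]
  have e1 := hR s (h1.trans hs.1) hsE
  rw [one_mul, Real.norm_of_nonneg (characteristic_nonneg (hr1.trans hs.1)),
    Real.norm_of_nonneg (characteristic_nonneg (hr1.trans hs.1))] at e1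
  calc characteristic a ⊤ r ≤ characteristic a ⊤ s :=
        characteristic_monotoneOn ha (Set.mem_Ioi.2 (by linarith)) (Set.mem_Ioi.2 hs0) hs.1
    _ ≤ characteristic f ⊤ s := e1
    _ ≤ s ^ K := hQ s (h2.trans hs.1)
    _ ≤ s ^ |K| := Real.rpow_le_rpow_of_exponent_le (hr1.trans hs.1) (le_abs_self K)
    _ ≤ (r ^ (2 : ℝ)) ^ |K| := by
        refine Real.rpow_le_rpow hs0.le (hs.2.trans ?_) (abs_nonneg K)
        rw [Real.rpow_two, sq]
        gcongr
    _ = r ^ (2 * |K|) := by rw [Real.rpow_mul (by linarith)]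

theorem isLittleO_const_characteristic {f : ℂ → ℂ} (hT : Tendsto (characteristic f ⊤) atTop atTop)
    (C : ℝ) : (fun _ : ℝ => C) =o[logMeasureFilter] characteristic f ⊤ :=
  Asymptotics.isLittleO_const_left.2 (Or.inr
    (tendsto_norm_atTop_atTop.comp (hT.mono_left logMeasureFilter_le_atTop)))

theorem eventually_logCounting_shift_le {f : ℂ → ℂ} (hf : Meromorphic f)
    (hT : Tendsto (characteristic f ⊤) atTop atTop) {K : ℝ}
    (hK : ∀ᶠ r in atTop, characteristic f ⊤ r ≤ r ^ K) (c : ℂ) :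
    ∀ᶠ r in logMeasureFilter,
      logCounting (fun z => f (z + c)) ⊤ r ≤ 3 / 2 * characteristic f ⊤ r := by
  have hfc := hf.shift c
  obtain ⟨C, hC⟩ := logCounting_comp_add_le
    (negPart_nonneg (MeromorphicOn.divisor f Set.univ)) (c := c)
    (D' := (MeromorphicOn.divisor (fun z => f (z + c)) Set.univ)⁻) (fun z => by
      rw [Function.locallyFinsuppWithin.negPart_apply, Function.locallyFinsuppWithin.negPart_apply,
        MeromorphicOn.divisor_apply (fun z _ => hfc z) (Set.mem_univ z),
        MeromorphicOn.divisor_apply (fun z _ => hf z) (Set.mem_univ (z + c)),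
        meromorphicOrderAt_fun_comp_add_const_eq_meromorphicOrderAt])
    (show (1 : ℝ) < 5 / 4 by norm_num)
  have hgrow := (characteristic_monotoneOn hf).eventually_le_mul (hT.eventually_ge_atTop 1) hK
    (show (1 : ℝ) < 11 / 10 by norm_num)
  have hs : Tendsto (fun r : ℝ => r ^ (3 / 4 : ℝ)) atTop atTop := tendsto_rpow_atTop (by norm_num)
  filter_upwards [hgrow, logMeasureFilter_le_atTop (eventually_ge_atTop 1),
    logMeasureFilter_le_atTop (hT.eventually_ge_atTop (8 * |C|)),
    logMeasureFilter_le_atTop (hs.eventually_ge_atTop ‖c‖)] with r h1 h2 h3 h4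
  have h5 := hC r h2
  rw [← logCounting_top, ← logCounting_top] at h5
  have h6 := logCounting_le_characteristic f ⊤ (r + ‖c‖)
  have hn := norm_nonneg c
  have h7 : characteristic f ⊤ (r + ‖c‖) ≤ characteristic f ⊤ (r + 2 * r ^ (3 / 4 : ℝ)) :=
    characteristic_monotoneOn hf (Set.mem_Ioi.2 (by linarith)) (Set.mem_Ioi.2 (by linarith))
      (by linarith)
  -- 5/4 · 11/10 = 11/8, and the remaining T/8 absorbs C.
  linarith [le_abs_self C]

/-! ### A difference analogue of the second main theorem -/

/-- Bound the largest term by M; every other term is its own minimum with the largest. The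
generality covers both log⁺ in ℝ and multiplicities in ℕ∞. -/
theorem sum_le_add_sum_sum {ι α : Type*} [Fintype ι] [AddCommMonoid α] [LinearOrder α]
    [IsOrderedAddMonoid α] {p : ι → α} {d : ι → ι → α} {M : α} (hM0 : 0 ≤ M) (hM : ∀ k, p k ≤ M)
    (hd0 : ∀ j k, 0 ≤ d j k) (hd : ∀ j k, j ≠ k → min (p j) (p k) ≤ d j k) :
    ∑ k, p k ≤ M + ∑ j, ∑ k, d j k := by
  classical
  rcases isEmpty_or_nonempty ι with h | h
  · simpa using hM0
  obtain ⟨k₀, hk₀⟩ := Finite.exists_max p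
  rw [← Finset.add_sum_erase _ _ (Finset.mem_univ k₀)]
  refine add_le_add (hM k₀) ?_
  calc ∑ k ∈ Finset.univ.erase k₀, p k ≤ ∑ k ∈ Finset.univ.erase k₀, d k₀ k := by
        refine Finset.sum_le_sum fun k hk => ?_
        have := hd k₀ k (Finset.ne_of_mem_erase hk).symm
        rwa [min_eq_right (hk₀ k)] at this
    _ ≤ ∑ k, d k₀ k :=
        Finset.sum_le_sum_of_subset_of_nonneg (Finset.subset_univ _) fun k _ _ => hd0 k₀ k
    _ ≤ ∑ j, ∑ k, d j k :=
        Finset.single_le_sum (f := fun j => ∑ k, d j k)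
          (fun j _ => Finset.sum_nonneg fun k _ => hd0 j k) (Finset.mem_univ k₀)

/-- The larger of |x| and |y| is at least |x − y|/2. -/
theorem min_posLog_norm_inv_le {x y : ℂ} (hx : x ≠ 0) (hxy : x ≠ y) :
    min (Real.posLog ‖x⁻¹‖) (Real.posLog ‖y⁻¹‖) ≤ Real.posLog ‖(x - y)⁻¹‖ + Real.log 2 := by
  wlog h : ‖y‖ ≤ ‖x‖ generalizing x y
  · rw [min_comm, ← norm_neg (x - y)⁻¹, ← inv_neg, neg_sub]
    refine this (norm_pos_iff.1 ((norm_nonneg x).trans_lt (not_le.1 h))) hxy.symm (not_le.1 h).le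
  refine (min_le_left _ _).trans ?_
  have h1 : 0 < ‖x‖ := norm_pos_iff.2 hx
  have h2 : 0 < ‖x - y‖ := norm_pos_iff.2 (sub_ne_zero.2 hxy)
  have h3 : ‖x⁻¹‖ ≤ 2 * ‖(x - y)⁻¹‖ := by
    rw [norm_inv, norm_inv, ← div_eq_mul_inv, inv_eq_one_div, div_le_div_iff₀ h1 h2]
    linarith [norm_sub_le x y]
  refine (Real.posLog_le_posLog (norm_nonneg _) h3).trans (Real.posLog_mul.trans ?_)
  rw [add_comm, Real.posLog_eq_log (by norm_num : (1 : ℝ) ≤ |2|)]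

/-- Since 1/x_k = δ⁻¹(q_k − 1), one bound in terms of δ⁻¹ serves all k, and it is paid only once:
two of the 1/x_k are large together only if some x_j − x_k is small. -/
theorem sum_posLog_norm_inv_le {ι : Type*} [Fintype ι] {x q : ι → ℂ} {δ : ℂ} (hδ : δ ≠ 0)
    (hq : ∀ k, δ = x k * (q k - 1)) (hx : ∀ j k, j ≠ k → x j - x k ≠ 0) :
    ∑ k, Real.posLog ‖(x k)⁻¹‖ ≤
      (Real.posLog ‖δ⁻¹‖ + ∑ k, (Real.posLog ‖q k‖ + Real.log 2)) +
        ∑ j, ∑ k, (Real.posLog ‖(x j - x k)⁻¹‖ + Real.log 2) := by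
  have hlog : 0 ≤ Real.log 2 := Real.log_nonneg (by norm_num)
  have hx0 : ∀ k, x k ≠ 0 := fun k h => hδ (by rw [hq k, h, zero_mul])
  have hnn : ∀ k, 0 ≤ Real.posLog ‖q k‖ + Real.log 2 := fun k =>
    add_nonneg Real.posLog_nonneg hlog
  refine sum_le_add_sum_sum (add_nonneg Real.posLog_nonneg (Finset.sum_nonneg fun k _ => hnn k))
    (fun k => ?_) (fun j k => add_nonneg Real.posLog_nonneg hlog)
    fun j k hjk => min_posLog_norm_inv_le (hx0 j) (sub_ne_zero.1 (hx j k hjk))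
  have h1 : (x k)⁻¹ = δ⁻¹ * (q k + -1) := by
    have h0 := hx0 k
    rw [hq k] at hδ
    have h2 : q k - 1 ≠ 0 := right_ne_zero_of_mul hδ
    rw [hq k]
    field_simp
    ring
  rw [h1, norm_mul]
  refine Real.posLog_mul.trans (add_le_add le_rfl ?_)
  refine le_trans ?_ (Finset.single_le_sum (f := fun k => Real.posLog ‖q k‖ + Real.log 2)
    (fun k _ => hnn k) (Finset.mem_univ k))
  refine (Real.posLog_norm_add_le _ _).trans ?_
  simp

theorem sum_proximity_inv_le {ι : Type*} [Fintype ι] {x q : ι → ℂ → ℂ} {δ : ℂ → ℂ}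
    (hx : ∀ k, Meromorphic (x k)) (hqm : ∀ k, Meromorphic (q k)) (hδ : Meromorphic δ)
    (hδ0 : ∀ᶠ z in codiscrete ℂ, δ z ≠ 0)
    (hq : ∀ k, ∀ᶠ z in codiscrete ℂ, δ z = x k z * (q k z - 1))
    (hne : ∀ j k, j ≠ k → ∀ᶠ z in codiscrete ℂ, x j z - x k z ≠ 0) {r : ℝ} (hr : r ≠ 0) :
    ∑ k, proximity (x k)⁻¹ ⊤ r ≤
      (proximity δ⁻¹ ⊤ r + ∑ k, (proximity (q k) ⊤ r + Real.log 2)) +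
        ∑ j, ∑ k, (proximity (x j - x k)⁻¹ ⊤ r + Real.log 2) := by
  have hint : ∀ {F : ℂ → ℂ}, Meromorphic F → CircleIntegrable (fun z => Real.posLog ‖F z‖) 0 r :=
    fun hF => MeromorphicOn.circleIntegrable_posLog_norm fun z _ => hF z
  have hint' : ∀ {F : ℂ → ℂ}, Meromorphic F →
      CircleIntegrable (fun z => Real.posLog ‖F z‖ + Real.log 2) 0 r :=
    fun hF => (hint hF).add (circleIntegrable_const _ _ _)
  have hconst : ∀ {F : ℂ → ℂ}, Meromorphic F →
      Real.circleAverage (fun z => Real.posLog ‖F z‖ + Real.log 2) 0 r =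
        proximity F ⊤ r + Real.log 2 := fun hF => by
    rw [Real.circleAverage_fun_add (hint hF) (circleIntegrable_const _ _ _),
      Real.circleAverage_const, proximity_top]
  have hd : ∀ j k, Meromorphic (x j - x k)⁻¹ := fun j k z => ((hx j z).sub (hx k z)).inv
  have hxi : ∀ k, Meromorphic (x k)⁻¹ := fun k z => (hx k z).inv
  have hδi : Meromorphic δ⁻¹ := fun z => (hδ z).inv
  have i1 := CircleIntegrable.fun_sum Finset.univ fun k _ => hint (hxi k)
  have i2 := CircleIntegrable.fun_sum Finset.univ fun k _ => hint' (hqm k)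
  have i3 : ∀ j, CircleIntegrable _ 0 r := fun j =>
    CircleIntegrable.fun_sum Finset.univ fun k _ => hint' (hd j k)
  have i4 := CircleIntegrable.fun_sum Finset.univ fun j _ => i3 j
  have key := Real.circleAverage_mono_codiscreteWithin i1 (((hint hδi).add i2).add i4) hr (by
    refine codiscreteWithin_mono (Set.subset_univ _) ?_
    have e1 : ∀ᶠ z in codiscrete ℂ, ∀ k, δ z = x k z * (q k z - 1) := eventually_all.2 hq
    have e2 : ∀ᶠ z in codiscrete ℂ, ∀ j k, j ≠ k → x j z - x k z ≠ 0 :=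
      eventually_all.2 fun j => eventually_all.2 fun k => by
        by_cases h : j = k
        · simp [h]
        · simpa [h] using hne j k h
    filter_upwards [hδ0, e1, e2] with z h0 h1 h2
    exact sum_posLog_norm_inv_le h0 h1 h2)
  rw [Real.circleAverage_fun_sum fun k _ => hint (hxi k),
    Real.circleAverage_add ((hint hδi).add i2) i4, Real.circleAverage_add (hint hδi) i2,
    Real.circleAverage_fun_sum fun k _ => hint' (hqm k), Real.circleAverage_fun_sum fun j _ => i3 j]
    at key
  simp only [proximity_top]
  refine key.trans_eq' ?_ |>.trans_eq ?_
  · rfl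
  · congr 1
    · congr 1
      exact Finset.sum_congr rfl fun k _ => by rw [hconst (hqm k), proximity_top]
    · refine Finset.sum_congr rfl fun j _ => ?_
      rw [Real.circleAverage_fun_sum fun k _ => hint' (hd j k)]
      exact Finset.sum_congr rfl fun k _ => by rw [hconst (hd j k), proximity_top]

theorem Meromorphic.eventually_codiscrete_ne_zero {F G : ℂ → ℂ} (hF : Meromorphic F)
    (hG : Meromorphic G) (h : ¬ MeromorphicEq F G) : ∀ᶠ z in codiscrete ℂ, F z - G z ≠ 0 :=
  eventually_codiscrete_iff.2 fun z =>
    ((meromorphicOrderAt_ne_top_iff_eventually_ne_zero ((hF z).sub (hG z))).1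
      (meromorphicOrderAt_sub_ne_top hF hG h z))

/-- Periodicity of a keeps f − a nonperiodic, so its characteristic is unbounded, and smallness of a
makes that characteristic O(T(r,f)). -/
theorem isLittleO_proximity_shift_div_sub {c : ℂ} {f a : ℂ → ℂ} (hf : IsFiniteOrderMeromorphic f)
    (hper : ¬ IsPeriodicWith c f) (ha : Meromorphic a) (haper : IsPeriodicWith c a)
    (hsmall : characteristic a ⊤ =o[logMeasureFilter] characteristic f ⊤) :
    proximity (fun z => (f (z + c) - a (z + c)) / (f z - a z)) ⊤ =o[logMeasureFilter]
      characteristic f ⊤ := by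
  obtain ⟨K, hK⟩ := hf.exists_characteristic_le_rpow
  obtain ⟨K', hK'⟩ := exists_characteristic_le_rpow_of_isLittleO ha hsmall hK
  have hT := tendsto_characteristic_atTop hf.1 hper
  have hfa : ¬ MeromorphicEq f a := fun h => hper (h.isPeriodicWith haper)
  set h : ℂ → ℂ := fun z => f z - a z with hh
  have hm : Meromorphic h := fun z => (hf.1 z).sub (ha z)
  have hhper : ¬ IsPeriodicWith c h := fun hp => hper <| by
    filter_upwards [hp, haper] with z e1 e2
    simp only [hh, e2] at e1
    exact sub_left_injective e1
  have hpow : ∀ᶠ r in atTop, characteristic h ⊤ r ≤ r ^ (max 0 (max K K') + 2) := by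
    filter_upwards [hK, hK', eventually_ge_atTop 2] with r h1 h2 h3
    have hr : (1 : ℝ) ≤ r := by linarith
    set M := max 0 (max K K')
    have e1 := h1.trans (Real.rpow_le_rpow_of_exponent_le hr
      ((le_max_left K K').trans (le_max_right 0 _) : K ≤ M))
    have e2 := h2.trans (Real.rpow_le_rpow_of_exponent_le hr
      ((le_max_right K K').trans (le_max_right 0 _) : K' ≤ M))
    have e3 : characteristic h ⊤ r ≤ _ := characteristic_sub_top_le hf.1 ha hr
    have e4 : 1 ≤ r ^ M := Real.one_le_rpow hr (le_max_left 0 _)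
    -- The summand 2 in the exponent absorbs the factor 4, as r ≥ 2.
    have e5 : r ^ M * 4 ≤ r ^ M * r ^ 2 := mul_le_mul_of_nonneg_left (by nlinarith) (by linarith)
    rw [Real.rpow_add (by linarith), Real.rpow_two]
    linarith [Real.log_two_lt_d9]
  have hO : characteristic h ⊤ =O[logMeasureFilter] characteristic f ⊤ := by
    have h1 : (fun r => characteristic f ⊤ r + characteristic a ⊤ r + Real.log 2)
        =O[logMeasureFilter] characteristic f ⊤ :=
      ((Asymptotics.isBigO_refl _ _).add hsmall.isBigO).add
        (isLittleO_const_characteristic hT _).isBigO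
    refine Asymptotics.IsBigO.trans (Asymptotics.IsBigO.of_bound' ?_) h1
    filter_upwards [logMeasureFilter_le_atTop (eventually_ge_atTop 1)] with r hr
    rw [Real.norm_of_nonneg (characteristic_nonneg hr)]
    exact (characteristic_sub_top_le hf.1 ha hr).trans (le_abs_self _)
  exact (isLittleO_proximity_shift_div hm (meromorphicOrderAt_sub_ne_top hf.1 ha hfa)
    (tendsto_characteristic_atTop hm hhper) hpow c).trans_isBigO hO

theorem isLittleO_characteristic_sub_inv {f a b : ℂ → ℂ}
    (hT : Tendsto (characteristic f ⊤) atTop atTop) (ha : Meromorphic a) (hb : Meromorphic b)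
    (ha' : characteristic a ⊤ =o[logMeasureFilter] characteristic f ⊤)
    (hb' : characteristic b ⊤ =o[logMeasureFilter] characteristic f ⊤) :
    characteristic (a - b)⁻¹ ⊤ =o[logMeasureFilter] characteristic f ⊤ := by
  obtain ⟨M, hM⟩ := exists_characteristic_inv_le (h := a - b) fun z => (ha z).sub (hb z)
  refine Asymptotics.IsBigO.trans_isLittleO (Asymptotics.IsBigO.of_bound' ?_)
    ((ha'.add hb').add (isLittleO_const_characteristic hT (Real.log 2 + M)))
  filter_upwards [logMeasureFilter_le_atTop (eventually_ge_atTop 1)] with r hr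
  rw [Real.norm_of_nonneg (characteristic_nonneg hr)]
  refine le_trans ?_ (le_abs_self _)
  have h1 := characteristic_sub_top_le ha hb hr
  have h2 := (abs_le.1 (hM r)).1
  change characteristic (a - b) ⊤ r ≤ _ at h1
  linarith

/-- Writing f(z+c) − f = f · (f(z+c)/f − 1) costs m(r,f) only once; the poles of f(z+c) must still
be counted. -/
theorem characteristic_shift_sub_le {c : ℂ} {f : ℂ → ℂ} (hf : Meromorphic f)
    (hne : ∀ᶠ z in codiscrete ℂ, f z ≠ 0) {r : ℝ} (hr : 1 ≤ r) :
    characteristic (fun z => f (z + c) - f z) ⊤ r ≤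
      characteristic f ⊤ r + logCounting (fun z => f (z + c)) ⊤ r +
        (proximity (fun z => f (z + c) / f z) ⊤ r + Real.log 2) := by
  have hfc := hf.shift c
  have hq : Meromorphic fun z => f (z + c) / f z := fun z => (hfc z).div (hf z)
  have h1 : proximity (fun z => f (z + c) - f z) ⊤ r =
      proximity (f * ((fun z => f (z + c) / f z) + fun _ => -1)) ⊤ r := by
    refine proximity_congr_codiscrete ?_ (by linarith)
    filter_upwards [hne] with z hz
    simp only [Pi.mul_apply, Pi.add_apply]
    field_simp
    ring
  have h2 := proximity_mul_top_le hf
    (f₂ := (fun z => f (z + c) / f z) + fun _ => -1) (fun z => (hq z).add (.const _ z)) r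
  have h3 := proximity_add_top_le hq (f₂ := fun _ : ℂ => (-1 : ℂ)) (fun z => .const _ z) r
  have h4 := logCounting_add_top_le hfc (f₂ := -f) (fun z => (hf z).neg) hr
  rw [logCounting_neg_top hf, ← sub_eq_add_neg] at h4
  simp only [Pi.add_apply, proximity_const, norm_neg, norm_one, Real.posLog_one] at h2 h3 h4
  change logCounting (fun z => f (z + c) - f z) ⊤ r ≤ _ at h4
  simp only [characteristic, Pi.add_apply]
  linarith

/-- The first main theorem, summed over the targets, combined with the proximity bound and `hB`. The
loss 5/2 is the bound for T(r,δ): 1 from T(r,f) and 3/2 from the poles of f(z+c). -/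
theorem eventually_le_logCounting {ι : Type*} [Fintype ι] {c : ℂ} {f : ℂ → ℂ} {a : ι → ℂ → ℂ}
    (hf : IsFiniteOrderMeromorphic f) (hper : ¬ IsPeriodicWith c f)
    (ha : ∀ k, Meromorphic (a k)) (ha_distinct : ∀ j k, j ≠ k → ¬ MeromorphicEq (a j) (a k))
    (ha_periodic : ∀ k, IsPeriodicWith c (a k))
    (ha_small : ∀ k, characteristic (a k) ⊤ =o[logMeasureFilter] characteristic f ⊤)
    {B : Function.locallyFinsupp ℂ ℤ}
    (hB : ∑ k, (MeromorphicOn.divisor (f - a k) Set.univ)⁺ ≤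
      (MeromorphicOn.divisor (fun z => f (z + c) - f z) Set.univ)⁺ + B +
        2 • ∑ j, ∑ k, (MeromorphicOn.divisor (a j - a k) Set.univ)⁺) {ε : ℝ} (hε : 0 < ε) :
    ∀ᶠ r in logMeasureFilter, (Fintype.card ι - 5 / 2 - ε) * characteristic f ⊤ r ≤
      Function.locallyFinsuppWithin.logCounting B r := by
  have hT := tendsto_characteristic_atTop hf.1 hper
  obtain ⟨K, hK⟩ := hf.exists_characteristic_le_rpow
  have hfc := hf.1.shift c
  have hfa : ∀ k, ¬ MeromorphicEq f (a k) := fun k h => hper (h.isPeriodicWith (ha_periodic k))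
  have h0per : IsPeriodicWith c (0 : ℂ → ℂ) := EventuallyEq.refl _ _
  have hf0 : ¬ MeromorphicEq f 0 := fun h => hper (h.isPeriodicWith h0per)
  have hm0 : Meromorphic (0 : ℂ → ℂ) := fun z => .const 0 z
  have hne : ∀ᶠ z in codiscrete ℂ, f z ≠ 0 := by
    simpa using hf.1.eventually_codiscrete_ne_zero hm0 hf0
  have hx : ∀ k, Meromorphic (f - a k) := fun k z => (hf.1 z).sub (ha k z)
  set q : ι → ℂ → ℂ := fun k z => (f (z + c) - a k (z + c)) / (f z - a k z) with hq
  have hqm : ∀ k, Meromorphic (q k) := fun k z =>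
    ((hfc z).sub ((ha k).shift c z)).div ((hf.1 z).sub (ha k z))
  set δ : ℂ → ℂ := fun z => f (z + c) - f z with hδ
  have hδm : Meromorphic δ := fun z => (hfc z).sub (hf.1 z)
  have hδ0 : ∀ᶠ z in codiscrete ℂ, δ z ≠ 0 := hfc.eventually_codiscrete_ne_zero hf.1 hper
  have hqδ : ∀ k, ∀ᶠ z in codiscrete ℂ, δ z = (f - a k) z * (q k z - 1) := fun k => by
    filter_upwards [ha_periodic k, hf.1.eventually_codiscrete_ne_zero (ha k) (hfa k)] with z e1 e2
    simp only [hδ, hq, Pi.sub_apply, e1]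
    field_simp
    ring
  have hxx : ∀ j k, (f - a j) - (f - a k) = a k - a j := fun j k => by abel
  have hdist : ∀ j k, j ≠ k → ∀ᶠ z in codiscrete ℂ, (f - a j) z - (f - a k) z ≠ 0 :=
    fun j k hjk => by
      filter_upwards [(ha k).eventually_codiscrete_ne_zero (ha j) (ha_distinct k j hjk.symm)]
        with z hz
      rwa [← Pi.sub_apply, hxx]
  obtain ⟨Mδ, hMδ⟩ := exists_characteristic_inv_le hδm
  choose M hM using fun k => exists_characteristic_inv_le (hx k)
  -- All error terms of the final inequality, each of them o(T(r,f)).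
  set E : ℝ → ℝ := fun r => ∑ k, (characteristic (a k) ⊤ r + (Real.log 2 + M k)) +
    ∑ k, (proximity (q k) ⊤ r + Real.log 2) +
    ∑ j, ∑ k, (characteristic (a k - a j)⁻¹ ⊤ r + Real.log 2) +
    2 * ∑ j, ∑ k, characteristic (a j - a k)⁻¹ ⊤ r +
    (proximity (fun z => f (z + c) / f z) ⊤ r + (Real.log 2 + Mδ)) with hE
  have hconst := isLittleO_const_characteristic hT
  have hd := fun j k => isLittleO_characteristic_sub_inv hT (ha j) (ha k) (ha_small j) (ha_small k)
  have hq0 : proximity (fun z => f (z + c) / f z) ⊤ =o[logMeasureFilter] characteristic f ⊤ := by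
    have h0small : characteristic (0 : ℂ → ℂ) ⊤ =o[logMeasureFilter] characteristic f ⊤ := by
      have : characteristic (0 : ℂ → ℂ) ⊤ = 0 := by
        ext r
        change proximity (fun _ : ℂ => (0 : ℂ)) ⊤ r + logCounting (fun _ : ℂ => (0 : ℂ)) ⊤ r = 0
        simp
      rw [this]
      exact Asymptotics.isLittleO_zero _ _
    simpa using isLittleO_proximity_shift_div_sub hf hper hm0 h0per h0small
  have hEo : E =o[logMeasureFilter] characteristic f ⊤ := by
    refine ((((Asymptotics.IsLittleO.fun_sum fun k _ => (ha_small k).add (hconst _)).add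
      (Asymptotics.IsLittleO.fun_sum fun k _ => (isLittleO_proximity_shift_div_sub hf hper (ha k)
        (ha_periodic k) (ha_small k)).add (hconst _))).add
      (Asymptotics.IsLittleO.fun_sum fun j _ => Asymptotics.IsLittleO.fun_sum fun k _ =>
        (hd k j).add (hconst _))).add
      ((Asymptotics.IsLittleO.fun_sum fun j _ => Asymptotics.IsLittleO.fun_sum fun k _ =>
        hd j k).const_mul_left 2)).add (hq0.add (hconst _))
  filter_upwards [hEo.bound hε, logMeasureFilter_le_atTop (eventually_ge_atTop 1),
    eventually_logCounting_shift_le hf.1 hT hK c] with r hEr hr hshift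
  rw [Real.norm_of_nonneg (characteristic_nonneg hr)] at hEr
  have hEr' := (le_abs_self _).trans hEr
  have hprox := sum_proximity_inv_le hx hqm hδm hδ0 hqδ hdist (by linarith : r ≠ 0)
  have hcount := Function.locallyFinsuppWithin.logCounting_le hB hr
  simp only [map_sum, map_add, Finset.sum_apply, Pi.add_apply, two_nsmul,
    ← logCounting_zero, ← logCounting_inv] at hcount
  have h1 : ∀ k, characteristic f ⊤ r ≤ proximity (f - a k)⁻¹ ⊤ r +
      logCounting (f - a k)⁻¹ ⊤ r + (characteristic (a k) ⊤ r + (Real.log 2 + M k)) := fun k => by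
    have e1 := characteristic_add_top_le (hx k) (ha k) hr
    rw [sub_add_cancel] at e1
    have e2 := (abs_le.1 (hM k r)).2
    have e3 : characteristic (f - a k)⁻¹ ⊤ r = proximity (f - a k)⁻¹ ⊤ r +
      logCounting (f - a k)⁻¹ ⊤ r := rfl
    linarith
  have h2 := Finset.sum_le_sum fun k (_ : k ∈ Finset.univ) => h1 k
  rw [Finset.sum_add_distrib, Finset.sum_add_distrib, Finset.sum_const, Finset.card_univ,
    nsmul_eq_mul] at h2
  have h3 : ∑ j, ∑ k, (proximity ((f - a j) - (f - a k))⁻¹ ⊤ r + Real.log 2) ≤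
      ∑ j, ∑ k, (characteristic (a k - a j)⁻¹ ⊤ r + Real.log 2) := by
    refine Finset.sum_le_sum fun j _ => Finset.sum_le_sum fun k _ => ?_
    rw [hxx]
    exact add_le_add (proximity_le_characteristic _ hr) le_rfl
  have h4 : ∑ j, ∑ k, logCounting (a j - a k)⁻¹ ⊤ r ≤
      ∑ j, ∑ k, characteristic (a j - a k)⁻¹ ⊤ r :=
    Finset.sum_le_sum fun j _ => Finset.sum_le_sum fun k _ => logCounting_le_characteristic _ _ _
  have h5 : characteristic δ ⊤ r ≤ _ := characteristic_shift_sub_le (c := c) hf.1 hne hr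
  have h6 := (abs_le.1 (hMδ r)).1
  have h7 : characteristic δ⁻¹ ⊤ r = proximity δ⁻¹ ⊤ r + logCounting δ⁻¹ ⊤ r := rfl
  simp only [hE] at hEr'
  linarith

/-! ### Multiplicities -/

theorem zeroMultiplicity_congr {F G : ℂ → ℂ} {z : ℂ} (h : F =ᶠ[𝓝[≠] z] G) :
    zeroMultiplicity F z = zeroMultiplicity G z := by
  rw [zeroMultiplicity, zeroMultiplicity, meromorphicOrderAt_congr h]

theorem monotone_map_toNat : Monotone (WithTop.map Int.toNat) :=
  Monotone.withTop_map fun _ _ => Int.toNat_le_toNat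

theorem min_zeroMultiplicity_le {F G : ℂ → ℂ} (hF : Meromorphic F) (hG : Meromorphic G) (z : ℂ) :
    min (zeroMultiplicity F z) (zeroMultiplicity G z) ≤
      zeroMultiplicity (fun w => F w - G w) z := by
  have h := meromorphicOrderAt_add (hF z) (hG z).neg
  rw [← meromorphicOrderAt_neg, ← sub_eq_add_neg] at h
  exact (monotone_map_toNat.map_min).symm.trans_le (monotone_map_toNat h)

theorem zeroMultiplicity_sub_eq_toNat_divisor {F G : ℂ → ℂ} (hF : Meromorphic F)
    (hG : Meromorphic G) (h : ¬ MeromorphicEq F G) (z : ℂ) :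
    zeroMultiplicity (fun w => F w - G w) z =
      ((MeromorphicOn.divisor (fun w => F w - G w) Set.univ z).toNat : ℕ∞) := by
  have hm : MeromorphicOn (fun w => F w - G w) Set.univ := fun z _ => (hF z).sub (hG z)
  rw [MeromorphicOn.divisor_apply hm (Set.mem_univ z), zeroMultiplicity]
  lift meromorphicOrderAt (fun w => F w - G w) z to ℤ
    using meromorphicOrderAt_sub_ne_top hF hG h z with n
  rfl

/-- At a zero of a periodic h, z+c is a zero as well and h(w+c) − h(w) ≡ 0, so the pair counts
infinitely often. -/
theorem unpairedMultiplicity_eq_zero {c : ℂ} {h : ℂ → ℂ} (hper : IsPeriodicWith c h) (z : ℂ) :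
    unpairedMultiplicity c h z = 0 := by
  have hz := eventually_codiscrete_iff.1 hper z
  rw [unpairedMultiplicity]
  by_cases h0 : zeroMultiplicity h z = 0
  · rw [h0, zero_tsub]
  have h1 : zeroMultiplicity h (z + c) = zeroMultiplicity h z := by
    rw [← zeroMultiplicity_congr hz, zeroMultiplicity, zeroMultiplicity,
      meromorphicOrderAt_fun_comp_add_const_eq_meromorphicOrderAt]
  have h2 : zeroMultiplicity (fun w => h (w + c) - h w) z = ⊤ := by
    have : meromorphicOrderAt (fun w => h (w + c) - h w) z = ⊤ :=
      meromorphicOrderAt_eq_top_iff.2 (hz.mono fun w hw => sub_eq_zero.2 hw)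
    rw [zeroMultiplicity, this]
    rfl
  rw [pairMultiplicity, if_pos ⟨h0, h1 ▸ h0⟩, h2]
  simp

/-- By periodicity a cancels from the difference, so the pairs of all targets are zeros of one and
the same function. -/
theorem pairMultiplicity_sub_le {c : ℂ} {f a : ℂ → ℂ} (ha : IsPeriodicWith c a) (z : ℂ) :
    pairMultiplicity c (fun w => f w - a w) z ≤ zeroMultiplicity (fun w => f (w + c) - f w) z := by
  rw [pairMultiplicity]
  split_ifs
  · refine (zeroMultiplicity_congr ?_).le
    filter_upwards [eventually_codiscrete_iff.1 ha z] with w hw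
    rw [hw]
    ring
  · exact zero_le

theorem min_zeroMultiplicity_sub_le {f a b : ℂ → ℂ} (hf : Meromorphic f) (ha : Meromorphic a)
    (hb : Meromorphic b) (z : ℂ) :
    min (zeroMultiplicity (fun w => f w - a w) z) (zeroMultiplicity (fun w => f w - b w) z) ≤
      zeroMultiplicity (fun w => a w - b w) z := by
  rw [min_comm]
  refine (min_zeroMultiplicity_le (fun z => (hf z).sub (hb z)) (fun z => (hf z).sub (ha z))
    z).trans_eq (zeroMultiplicity_congr (.of_forall fun w => ?_))
  simp only [Pi.sub_apply]
  ring

section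

variable {ι : Type*} [Fintype ι] [DecidableEq ι] {c : ℂ} {f : ℂ → ℂ} {a : ι → ℂ → ℂ}

/-- Each p splits as (p − ν)⁺ + min(p, ν). The second parts share the bound by the order of f(w+c) −
f(w), and two of them are positive together only at a common value of two targets. -/
theorem sum_zeroMultiplicity_le (hf : Meromorphic f) (ha : ∀ k, Meromorphic (a k))
    (ha_periodic : ∀ k, IsPeriodicWith c (a k)) (z : ℂ) :
    ∑ k, zeroMultiplicity (fun w => f w - a k w) z ≤
      (∑ k, unpairedMultiplicity c (fun w => f w - a k w) z) +
        (zeroMultiplicity (fun w => f (w + c) - f w) z +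
          ∑ j, ∑ k, if j = k then 0 else zeroMultiplicity (fun w => a j w - a k w) z) := by
  have h1 : ∀ k, zeroMultiplicity (fun w => f w - a k w) z ≤
      unpairedMultiplicity c (fun w => f w - a k w) z +
        min (zeroMultiplicity (fun w => f w - a k w) z)
          (pairMultiplicity c (fun w => f w - a k w) z) := fun k => by
    rcases le_total (zeroMultiplicity (fun w => f w - a k w) z)
      (pairMultiplicity c (fun w => f w - a k w) z) with h | h
    · rw [min_eq_left h]
      exact le_add_self
    · rw [min_eq_right h]
      exact le_tsub_add
  refine (Finset.sum_le_sum fun k _ => h1 k).trans ?_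
  rw [Finset.sum_add_distrib]
  refine add_le_add le_rfl (sum_le_add_sum_sum zero_le
    (fun k => (min_le_right _ _).trans (pairMultiplicity_sub_le (ha_periodic k) z))
    (fun _ _ => zero_le) fun j k hjk => ?_)
  rw [if_neg hjk]
  exact (min_le_min (min_le_left _ _) (min_le_left _ _)).trans
    (min_zeroMultiplicity_sub_le hf (ha j) (ha k) z)

/-- A shared unpaired count is at most the multiplicity for f and for g, hence at most that of z as
a zero of f − g. -/
theorem sum_unpairedMultiplicity_le {g : ℂ → ℂ} (hf : Meromorphic f) (hg : Meromorphic g)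
    (ha : ∀ k, Meromorphic (a k)) (hshare : ∀ k, ShareIgnoringPairs c f g (a k)) (z : ℂ) :
    ∑ k, unpairedMultiplicity c (fun w => f w - a k w) z ≤
      zeroMultiplicity (fun w => f w - g w) z +
        ∑ j, ∑ k, if j = k then 0 else zeroMultiplicity (fun w => a j w - a k w) z := by
  refine sum_le_add_sum_sum zero_le (fun k => ?_) (fun _ _ => zero_le) fun j k hjk => ?_
  · refine (le_min (tsub_le_self (a := zeroMultiplicity (fun w => f w - a k w) z))
      ((hshare k z).le.trans tsub_le_self)).trans
      ((min_zeroMultiplicity_le (fun z => (hf z).sub (ha k z)) (fun z => (hg z).sub (ha k z))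
        z).trans_eq (zeroMultiplicity_congr (.of_forall fun w => ?_)))
    simp only [Pi.sub_apply]
    ring
  · rw [if_neg hjk]
    exact (min_le_min tsub_le_self tsub_le_self).trans
      (min_zeroMultiplicity_sub_le hf (ha j) (ha k) z)

/-- Common zeros of f − a_j and f − a_k are charged twice, for paired and for unpaired points; hence
the factor 2 in `eventually_le_logCounting`. -/
theorem eventually_le_logCounting_of_sum_unpairedMultiplicity_le
    (hf : IsFiniteOrderMeromorphic f) (hper : ¬ IsPeriodicWith c f)
    (ha : ∀ k, Meromorphic (a k)) (ha_distinct : ∀ j k, j ≠ k → ¬ MeromorphicEq (a j) (a k))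
    (ha_periodic : ∀ k, IsPeriodicWith c (a k))
    (ha_small : ∀ k, characteristic (a k) ⊤ =o[logMeasureFilter] characteristic f ⊤)
    {B : Function.locallyFinsupp ℂ ℤ} (hB0 : 0 ≤ B)
    (hB : ∀ z, ∑ k, unpairedMultiplicity c (fun w => f w - a k w) z ≤ ((B z).toNat : ℕ∞) +
      ∑ j, ∑ k, if j = k then 0 else zeroMultiplicity (fun w => a j w - a k w) z)
    {ε : ℝ} (hε : 0 < ε) :
    ∀ᶠ r in logMeasureFilter, (Fintype.card ι - 5 / 2 - ε) * characteristic f ⊤ r ≤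
      Function.locallyFinsuppWithin.logCounting B r := by
  refine eventually_le_logCounting hf hper ha ha_distinct ha_periodic ha_small (fun z => ?_) hε
  have hfa : ∀ k, ¬ MeromorphicEq f (a k) := fun k h => hper (h.isPeriodicWith (ha_periodic k))
  have h := (sum_zeroMultiplicity_le hf.1 ha ha_periodic z).trans (add_le_add (hB z) le_rfl)
  have hposPart : ∀ n : ℤ, n⁺ = (n.toNat : ℤ) := fun n => (Int.toNat_eq_max n).symm
  have hd : (∑ j, ∑ k, if j = k then 0 else zeroMultiplicity (fun w => a j w - a k w) z) ≤
      ((∑ j, ∑ k, (MeromorphicOn.divisor (a j - a k) Set.univ z).toNat : ℕ) : ℕ∞) := by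
    push_cast
    refine Finset.sum_le_sum fun j _ => Finset.sum_le_sum fun k _ => ?_
    split_ifs with hjk
    · exact zero_le
    · exact (zeroMultiplicity_sub_eq_toNat_divisor (ha j) (ha k) (ha_distinct j k hjk) z).le
  rw [zeroMultiplicity_sub_eq_toNat_divisor (hf.1.shift c) hf.1 hper z,
    Finset.sum_congr rfl fun k _ =>
      zeroMultiplicity_sub_eq_toNat_divisor hf.1 (ha k) (hfa k) z] at h
  have h' := h.trans (add_le_add (add_le_add le_rfl hd) (add_le_add le_rfl hd))
  norm_cast at h'
  have h2 := Int.toNat_of_nonneg (hB0 z)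
  simp only [two_nsmul, Function.locallyFinsuppWithin.coe_add,
    Function.locallyFinsuppWithin.coe_sum, Finset.sum_apply, Pi.add_apply,
    Function.locallyFinsuppWithin.posPart_apply, hposPart]
  zify at h'
  change (∑ k, ((MeromorphicOn.divisor (fun w => f w - a k w) Set.univ z).toNat : ℤ)) ≤ _
  linarith

end

/-! ### Comparison of the two characteristics and conclusion -/

theorem eventually_mul_characteristic_le {c : ℂ} {f g : ℂ → ℂ} {a : Fin 5 → ℂ → ℂ}
    (hf : IsFiniteOrderMeromorphic f) (hg : Meromorphic g) (hper : ¬ IsPeriodicWith c f)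
    (ha : ∀ k, Meromorphic (a k)) (ha_distinct : ∀ j k, j ≠ k → ¬ MeromorphicEq (a j) (a k))
    (ha_periodic : ∀ k, IsPeriodicWith c (a k))
    (ha_small : ∀ k, characteristic (a k) ⊤ =o[logMeasureFilter] characteristic f ⊤)
    (hshare : ∀ k, ShareIgnoringPairs c f g (a k)) (hfg : ¬ MeromorphicEq f g) :
    ∀ᶠ r in logMeasureFilter, 9 / 8 * characteristic f ⊤ r ≤ characteristic g ⊤ r := by
  have hm : Meromorphic (f - g) := fun z => (hf.1 z).sub (hg z)
  have key := eventually_le_logCounting_of_sum_unpairedMultiplicity_le hf hper ha ha_distinct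
    ha_periodic ha_small (posPart_nonneg (MeromorphicOn.divisor (f - g) Set.univ)) (fun z => by
      refine (sum_unpairedMultiplicity_le hf.1 hg ha hshare z).trans (add_le_add ?_ le_rfl)
      rw [zeroMultiplicity_sub_eq_toNat_divisor hf.1 hg hfg z,
        Function.locallyFinsuppWithin.posPart_apply]
      exact_mod_cast Int.toNat_le_toNat (le_posPart _)) (show (0 : ℝ) < 1 / 4 by norm_num)
  obtain ⟨M, hM⟩ := exists_characteristic_inv_le hm
  filter_upwards [key, logMeasureFilter_le_atTop (eventually_ge_atTop 1),
    logMeasureFilter_le_atTop ((tendsto_characteristic_atTop hf.1 hper).eventually_ge_atTop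
      (8 * (Real.log 2 + M)))] with r h1 hr h2
  rw [← logCounting_zero, ← logCounting_inv, Fintype.card_fin] at h1
  have h3 := logCounting_le_characteristic (f - g)⁻¹ ⊤ r
  have h4 : characteristic (f - g) ⊤ r ≤ _ := characteristic_sub_top_le hf.1 hg hr
  have h5 := (abs_le.1 (hM r)).1
  push_cast at h1
  -- With ε = 1/4 this reads 9/4 T(r,f) ≤ T(r,f) + T(r,g) + log 2 + M, and log 2 + M ≤ T(r,f)/8.
  linarith

/-- Otherwise B = 0 is admissible, and ε = 1 gives 3/2 T(r,f) ≤ 0. This settles the case where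
exactly one function is periodic. -/
theorem exists_unpairedMultiplicity_ne_zero {c : ℂ} {f : ℂ → ℂ} {a : Fin 5 → ℂ → ℂ}
    (hf : IsFiniteOrderMeromorphic f) (hper : ¬ IsPeriodicWith c f)
    (ha : ∀ k, Meromorphic (a k)) (ha_distinct : ∀ j k, j ≠ k → ¬ MeromorphicEq (a j) (a k))
    (ha_periodic : ∀ k, IsPeriodicWith c (a k))
    (ha_small : ∀ k, characteristic (a k) ⊤ =o[logMeasureFilter] characteristic f ⊤) :
    ∃ k z, unpairedMultiplicity c (fun w => f w - a k w) z ≠ 0 := by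
  by_contra! h0
  have key := eventually_le_logCounting_of_sum_unpairedMultiplicity_le hf hper ha ha_distinct
    ha_periodic ha_small (le_refl 0) (fun z => by simp [h0]) (show (0 : ℝ) < 1 by norm_num)
  obtain ⟨r, h1, h2⟩ := (key.and (logMeasureFilter_le_atTop
    ((tendsto_characteristic_atTop hf.1 hper).eventually_ge_atTop 1))).exists
  rw [map_zero, Fintype.card_fin, Pi.zero_apply] at h1
  push_cast at h1
  linarith

theorem IsSmallFor.isLittleO {a f : ℂ → ℂ} (h : IsSmallFor a f) :
    characteristic a ⊤ =o[logMeasureFilter] characteristic f ⊤ := by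
  obtain ⟨-, E, hE, ho⟩ := h
  exact ho.mono hE.logMeasureFilter_le

theorem IsPeriodicWith.sub {c : ℂ} {f a : ℂ → ℂ} (hf : IsPeriodicWith c f)
    (ha : IsPeriodicWith c a) : IsPeriodicWith c fun z => f z - a z := by
  filter_upwards [hf, ha] with z h1 h2
  rw [h1, h2]

theorem mainTheorem4 (c : ℂ) (f g : ℂ → ℂ)
    (hf : IsFiniteOrderMeromorphic f) (hg : IsFiniteOrderMeromorphic g)
    (a : Fin 5 → ℂ → ℂ)
    (ha_distinct : ∀ j k, j ≠ k → ¬ MeromorphicEq (a j) (a k))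
    (ha_periodic : ∀ k, IsPeriodicWith c (a k))
    (ha_small : ∀ k, IsSmallFor (a k) f)
    (ha_small' : IsPeriodicWith c f → ∀ k, IsSmallFor (a k) g)
    (hshare : ∀ k, ShareIgnoringPairs c f g (a k)) :
    MeromorphicEq f g ∨ (IsPeriodicWith c f ∧ IsPeriodicWith c g) := by
  have ha : ∀ k, Meromorphic (a k) := fun k => (ha_small k).1
  by_cases hfper : IsPeriodicWith c f
  · refine Or.inr ⟨hfper, ?_⟩
    by_contra hgper
    obtain ⟨k, z, hkz⟩ := exists_unpairedMultiplicity_ne_zero hg hgper ha ha_distinct ha_periodic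
      fun k => (ha_small' hfper k).isLittleO
    exact hkz ((hshare k z).symm.trans
      (unpairedMultiplicity_eq_zero (hfper.sub (ha_periodic k)) z))
  by_cases hgper : IsPeriodicWith c g
  · obtain ⟨k, z, hkz⟩ := exists_unpairedMultiplicity_ne_zero hf hfper ha ha_distinct ha_periodic
      fun k => (ha_small k).isLittleO
    exact absurd ((hshare k z).trans
      (unpairedMultiplicity_eq_zero (hgper.sub (ha_periodic k)) z)) hkz
  left
  by_contra hfg
  have h1 := eventually_mul_characteristic_le hf hg.1 hfper ha ha_distinct ha_periodic
    (fun k => (ha_small k).isLittleO) hshare hfg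
  -- This makes the targets small for g too, so the argument can be repeated with f and g exchanged.
  have hO : characteristic f ⊤ =O[logMeasureFilter] characteristic g ⊤ := by
    refine Asymptotics.IsBigO.of_bound' ?_
    filter_upwards [h1, logMeasureFilter_le_atTop (eventually_ge_atTop 1)] with r h hr
    have h0 : 0 ≤ characteristic f ⊤ r := characteristic_nonneg hr
    rw [Real.norm_of_nonneg h0]
    refine le_trans ?_ (le_abs_self _)
    linarith
  have h2 := eventually_mul_characteristic_le hg hf.1 hgper ha ha_distinct ha_periodic
    (fun k => (ha_small k).isLittleO.trans_isBigO hO) (fun k z => (hshare k z).symm)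
    fun h => hfg h.symm
  obtain ⟨r, e1, e2, e3⟩ := (h1.and (h2.and (logMeasureFilter_le_atTop
    ((tendsto_characteristic_atTop hf.1 hfper).eventually_ge_atTop 1)))).exists
  linarith
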